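/- Let $k$ be a field, let $C$ be a coalgebra over $k$ with comultiplication $\Delta$ and counit $\varepsilon$, and let $e\in C$ be a group-like element, i.e. $\Delta(e)=e\otimes e$ and $\varepsilon(e)=1$. All tensor products without subscript are over $k$. Let ${}_e^C\mathbf{Alg}_e^C$ be the category whose objects are the unital $k$-algebras $P$ equipped with a right $C$-coaction $\Delta_P:P\to P\otimes C$ and a left $C$-coaction ${}_P\Delta:P\to C\otimes P$ (coassociative and counital; not assumed to commute with each other) such that $\Delta_P(1)=1\otimes e$ and ${}_P\Delta(1)=e\otimes 1$; morphisms are the unital algebra homomorphisms that are both right and left $C$-colinear. For an object $P$ put $$P^{\mathrm{co}\,C}:=\{b\in P \mid \Delta_P(bp)=b\,\Delta_P(p)\ \text{for all } p\in P\}=:B ,$$ a subalgebra of $P$, and let $$\mathsf{can}:P\otimes_B P\to P\otimes C,\qquad p\otimes_B p'\mapsto p\,\Delta_P(p').$$ The object $P$ is called *principal* if 1. $\mathsf{can}$ is bijective; 2. the canonical entwining $\psi:C\otimes P\to P\otimes C$, $\psi(c\otimes p)=\mathsf{can}\big(\mathsf{can}^{-1}(1\otimes c)\,p\big)$, is bijective;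 3. $P$ is $C$-equivariantly projective as a left $B$-module: the multiplication map $B\otimes P\to P$ has a left $B$-linear and right $C$-colinear splitting; 4. the left coaction is the one determined by the canonical entwining: ${}_P\Delta(p)=\psi^{-1}(p\otimes e)$ for all $p\in P$. **Lemma.** Let $\pi:P\to Q$ be a surjective morphism in ${}_e^C\mathbf{Alg}_e^C$ and suppose that $P$ is principal. Then: (i) $\pi$ restricts to a map $\pi^{\mathrm{co}\,C}:P^{\mathrm{co}\,C}\to Q^{\mathrm{co}\,C}$, and this map is surjective. (ii) If $Q\neq 0$, there is a right $C$-colinear map $\alpha_R:Q\to P$ with $\pi\circ\alpha_R=\mathrm{id}_Q$ and $\alpha_R(1)=1$. (iii) If $Q\neq 0$, there is a left $C$-colinear map $\alpha_L:Q\to P$ with $\pi\circ\alpha_L=\mathrm{id}_Q$ and $\alpha_L(1)=1$. (iv) $Q$ is principal. Furthermore, let $Q'\subseteq Q$ be a unital subalgebra that is an object of ${}_e^C\mathbf{Alg}_e^C$ in such a way that the inclusion $Q'\hookrightarrow Q$ is a morphism. If $Q'$ is principal, then the subalgebra $\pi^{-1}(Q')\subseteq P$ has exactly one structure of an object of ${}_e^C\mathbf{Alg}_e^C$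 for which the inclusion $\pi^{-1}(Q')\hookrightarrow P$ is a morphism, and with this structure $\pi^{-1}(Q')$ is principal. -/

import Mathlib

open scoped TensorProduct

/-- The structure that makes a unital `k`-algebra `P` an object of the category of unital algebras
with `e`-coaugmented left and right `C`-coactions: a right and a left coaction of `C` on the vector
space `P` (not assumed to commute with each other, nor to be multiplicative) that send `1` to
`1 ⊗ e` and to `e ⊗ 1` respectively. -/
@[ext]
structure CoaugCoactions (k : Type*) [Field k] {C : Type*} [AddCommGroup C] [Module k C]
    [Coalgebra k C] (e : C) (P : Type*) [Ring P] [Algebra k P] where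
  /-- the right coaction `P → P ⊗ C` -/
  right : P →ₗ[k] P ⊗[k] C
  /-- the left coaction `P → C ⊗ P` -/
  left : P →ₗ[k] C ⊗[k] P
  right_coassoc : (TensorProduct.assoc k P C C).toLinearMap ∘ₗ right.rTensor C ∘ₗ right =
    (Coalgebra.comul (R := k) (A := C)).lTensor P ∘ₗ right
  right_counit : (TensorProduct.rid k P).toLinearMap ∘ₗ
    (Coalgebra.counit (R := k) (A := C)).lTensor P ∘ₗ right = LinearMap.id
  left_coassoc : left.lTensor C ∘ₗ left = (TensorProduct.assoc k C C P).toLinearMap ∘ₗ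
    (Coalgebra.comul (R := k) (A := C)).rTensor P ∘ₗ left
  left_counit : (TensorProduct.lid k P).toLinearMap ∘ₗ
    (Coalgebra.counit (R := k) (A := C)).rTensor P ∘ₗ left = LinearMap.id
  right_one : right 1 = 1 ⊗ₜ[k] e
  left_one : left 1 = e ⊗ₜ[k] 1

namespace CoaugCoactions

variable {k : Type*} [Field k] {C : Type*} [AddCommGroup C] [Module k C] [Coalgebra k C] {e : C}
variable {P : Type*} [Ring P] [Algebra k P] {Q : Type*} [Ring Q] [Algebra k Q]

/-- `f` is right colinear: `Δ_Q ∘ f = (f ⊗ id) ∘ Δ_P`. -/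
def RightColinear (D : CoaugCoactions k e P) (E : CoaugCoactions k e Q) (f : P →ₗ[k] Q) : Prop :=
  E.right ∘ₗ f = f.rTensor C ∘ₗ D.right

/-- `f` is left colinear: `_QΔ ∘ f = (id ⊗ f) ∘ _PΔ`. -/
def LeftColinear (D : CoaugCoactions k e P) (E : CoaugCoactions k e Q) (f : P →ₗ[k] Q) : Prop :=
  E.left ∘ₗ f = f.lTensor C ∘ₗ D.left

/-- A morphism of the category: a bicolinear (unital) algebra homomorphism. -/
def IsMorphism (D : CoaugCoactions k e P) (E : CoaugCoactions k e Q) (f : P →ₐ[k] Q) : Prop :=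
  D.RightColinear E f.toLinearMap ∧ D.LeftColinear E f.toLinearMap

variable (D : CoaugCoactions k e P)

/-- The coaction-invariant subalgebra `P^{co C} = {b | Δ_P (b p) = b Δ_P (p) for all p}`, where
`P` acts on `P ⊗ C` by left multiplication on the first factor. -/
def coinv : Subalgebra k P where
  carrier := {b | ∀ p, D.right (b * p) = b • D.right p}
  mul_mem' := by
    intro a b ha hb p
    rw [mul_assoc, ha, hb, mul_smul]
  add_mem' := by
    intro a b ha hb p
    rw [add_mul, map_add, ha, hb, add_smul]
  algebraMap_mem' := by
    intro r p
    rw [← Algebra.smul_def, map_smul, algebraMap_smul]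

/-- The subspace of `P ⊗ P` spanned by the `p b ⊗ p' - p ⊗ b p'` with `b` in `B = P^{co C}`. -/
def balancing : Submodule k (P ⊗[k] P) :=
  Submodule.span k {t | ∃ p p' : P, ∃ b ∈ D.coinv, t = (p * b) ⊗ₜ[k] p' - p ⊗ₜ[k] (b * p')}

/-- The balanced tensor product `P ⊗_B P` over `B = P^{co C}` (`B` need not be commutative). -/
abbrev BalTensor : Type _ := (P ⊗[k] P) ⧸ D.balancing

/-- The lifted canonical map `P ⊗ P → P ⊗ C`, `p ⊗ p' ↦ p Δ_P (p')`. -/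
def canLift : P ⊗[k] P →ₗ[k] P ⊗[k] C :=
  TensorProduct.lift (LinearMap.mk₂ k (fun p p' => p • D.right p')
    (fun _ _ _ => add_smul _ _ _) (fun _ _ _ => smul_assoc _ _ _)
    (fun _ _ _ => by rw [map_add, smul_add])
    (fun _ _ _ => by rw [map_smul, smul_comm]))

theorem balancing_le_ker_canLift : D.balancing ≤ LinearMap.ker D.canLift := by
  refine Submodule.span_le.2 ?_
  rintro _ ⟨p, p', b, hb, rfl⟩
  have h : D.right (b * p') = b • D.right p' := hb p'
  simp [canLift, h, mul_smul]

/-- The canonical map `can : P ⊗_B P → P ⊗ C`, `p ⊗_B p' ↦ p Δ_P (p')`. -/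
def can : D.BalTensor →ₗ[k] P ⊗[k] C :=
  D.balancing.liftQ D.canLift D.balancing_le_ker_canLift

/-- Right multiplication by `q` on `P ⊗_B P`: `(p ⊗_B p') q = p ⊗_B (p' q)`. -/
def balMulRight (q : P) : D.BalTensor →ₗ[k] D.BalTensor :=
  D.balancing.mapQ D.balancing ((LinearMap.mulRight k q).lTensor P) (by
    refine Submodule.span_le.2 ?_
    rintro _ ⟨p, p', b, hb, rfl⟩
    refine Submodule.subset_span ⟨p, p' * q, b, hb, ?_⟩
    simp [mul_assoc])

theorem balMulRight_add (q q' : P) (t : D.BalTensor) :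
    D.balMulRight (q + q') t = D.balMulRight q t + D.balMulRight q' t := by
  obtain ⟨t, rfl⟩ := Submodule.Quotient.mk_surjective _ t
  have h : LinearMap.mulRight k (q + q') = LinearMap.mulRight k q + LinearMap.mulRight k q' := by
    ext; simp [mul_add]
  simp only [balMulRight, h, LinearMap.lTensor_add, Submodule.mapQ_apply]
  rfl

theorem balMulRight_smul (r : k) (q : P) (t : D.BalTensor) :
    D.balMulRight (r • q) t = r • D.balMulRight q t := by
  obtain ⟨t, rfl⟩ := Submodule.Quotient.mk_surjective _ t
  have h : LinearMap.mulRight k (r • q) = r • LinearMap.mulRight k q := by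
    ext; simp
  simp only [balMulRight, h, LinearMap.lTensor_smul, Submodule.mapQ_apply]
  rfl

/-- The canonical entwining `ψ : C ⊗ P → P ⊗ C`, `c ⊗ p ↦ can (can⁻¹ (1 ⊗ c) p)`, of a
coalgebra-Galois extension. -/
noncomputable def entwining (h : Function.Bijective D.can) : C ⊗[k] P →ₗ[k] P ⊗[k] C :=
  TensorProduct.lift (LinearMap.mk₂ k
    (fun c p => D.can (D.balMulRight p ((LinearEquiv.ofBijective D.can h).symm (1 ⊗ₜ[k] c))))
    (fun _ _ _ => by rw [TensorProduct.tmul_add, map_add, map_add, map_add])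
    (fun _ _ _ => by rw [TensorProduct.tmul_smul, map_smul, map_smul, map_smul])
    (fun _ _ _ => by rw [balMulRight_add, map_add])
    (fun _ _ _ => by rw [balMulRight_smul, map_smul]))

/-- `P` is `C`-equivariantly projective as a left `B`-module, `B = P^{co C}`: the multiplication
map `B ⊗ P → P` has a left `B`-linear and right `C`-colinear splitting `s`. -/
def EquivariantlyProjective : Prop :=
  ∃ s : P →ₗ[k] D.coinv ⊗[k] P,
    (∀ p, LinearMap.mul' k P (D.coinv.val.toLinearMap.rTensor P (s p)) = p) ∧
    (∀ (b : D.coinv) (p : P), s (b * p) = b • s p) ∧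
    D.right.lTensor D.coinv ∘ₗ s =
      (TensorProduct.assoc k D.coinv P C).toLinearMap ∘ₗ s.rTensor C ∘ₗ D.right

/-- An object of the category is principal: the canonical map is bijective, the canonical entwining
`ψ` is bijective, `P` is equivariantly projective (the right coaction being `e`-coaugmented is part
of the structure), and the left coaction of `P` is the one that a principal extension carries,
`p ↦ ψ⁻¹ (p ⊗ e)`. -/
def IsPrincipal : Prop :=
  ∃ h : Function.Bijective D.can, Function.Bijective (D.entwining h) ∧
    D.EquivariantlyProjective ∧ ∀ p, D.entwining h (D.left p) = p ⊗ₜ[k] e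

end CoaugCoactions

/-! Everything rests on strong connections, the bicolinear maps l : C → P ⊗ P with mul ∘ l = ε.
Colinearity forces the lifted canonical map to send l(c) to 1 ⊗ c, so l replaces the inverse of can
by a formula in the coactions and the product, which can be carried along morphisms.

A principal P has a strong connection (`IsPrincipal.exists_strongConnection`): if s is the
equivariant splitting, x ⊗ y ↦ x s(y) factors through can, and l(c) is the value at 1 ⊗ c.
Conversely, the identities collected in `PrincipalData` recover principality
(`PrincipalData.isPrincipal`). They push forward along surjections, which gives (iv), and pull back
to a subobject of a principal object when l takes values there.

The working property of l is that p₀ l(p₁) lies in B ⊗ P and l(p₋₁) p₀ lies in P ⊗ B, both with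
product p. For (i), lift a coinvariant b to p and apply a linear retraction τ : P → B to the second
leg of p₀ l(p₁). The product of the legs is in B, and its image is b because Δ(b) = b ⊗ e and
l(e)⁽¹⁾ τ(l(e)⁽²⁾) = 1. For (ii) and (iii), push the coinvariant leg to Q, lift it back by a linear
section of the coinvariants, and multiply. The result is a colinear section; a functional φ on Q
with φ(1) = 1 then serves to make it unital.

For the preimage of Q', lift a strong connection of Q' to L : C → P ⊗ P through a left colinear
section on the first leg and a right colinear one on the second. L need not be a strong connection,
but the failures of canL(L(c)) = c ⊗ 1 and can(L(c)) = 1 ⊗ c have their P-leg in ker π. Correcting L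
on the right by a strong connection l of P, and then on the left by the result, adds terms with a
leg in the ideal ker π ⊆ π⁻¹(Q'). The outcome is a strong connection of P with both legs in π⁻¹(Q')
(`IsPrincipal.exists_strongConnection_mem`). -/

namespace CoaugCoactions

/-! ### One-sided multiplications and linear extensions on tensor products. -/

section TensorActions

variable {k : Type*} [Field k] {P : Type*} [Ring P] [Algebra k P]
variable {X : Type*} [AddCommGroup X] [Module k X] {Y : Type*} [AddCommGroup Y] [Module k Y]
variable {M : Type*} [AddCommGroup M] [Module k M]

/-- The left `P`-linear extension `p ⊗ x ↦ p • g x` of a linear map `g` into a `P`-module. -/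
def sext {N : Type*} [AddCommMonoid N] [Module k N] [Module P N] [IsScalarTower k P N]
    [SMulCommClass P k N] (g : X →ₗ[k] N) : P ⊗[k] X →ₗ[k] N :=
  TensorProduct.lift (LinearMap.mk₂ k (fun p x => p • g x)
    (fun _ _ _ => add_smul _ _ _) (fun _ _ _ => smul_assoc _ _ _)
    (fun _ _ _ => by rw [map_add, smul_add])
    (fun _ _ _ => by rw [map_smul, smul_comm]))

section
variable {N : Type*} [AddCommMonoid N] [Module k N] [Module P N] [IsScalarTower k P N]
    [SMulCommClass P k N]

@[simp]
theorem sext_tmul (g : X →ₗ[k] N) (p : P) (x : X) : sext g (p ⊗ₜ[k] x) = p • g x := rfl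

theorem sext_smul (g : X →ₗ[k] N) (p : P) (t : P ⊗[k] X) : sext g (p • t) = p • sext g t := by
  induction t with
  | zero => simp
  | tmul a x => simp [TensorProduct.smul_tmul', mul_smul]
  | add a b ha hb => rw [smul_add, map_add, ha, hb, map_add, smul_add]

end

/-- Right multiplication by `p` on the last leg of `M ⊗ P`. -/
def rmul (p : P) : M ⊗[k] P →ₗ[k] M ⊗[k] P := (LinearMap.mulRight k p).lTensor M

@[simp]
theorem rmul_tmul (p : P) (m : M) (q : P) : rmul p (m ⊗ₜ[k] q) = m ⊗ₜ[k] (q * p) := rfl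

theorem rmul_add (p q : P) (t : M ⊗[k] P) : rmul (p + q) t = rmul p t + rmul q t := by
  induction t with
  | zero => simp
  | tmul a x => simp [mul_add, TensorProduct.tmul_add]
  | add a b ha hb => simp only [map_add, ha, hb]; abel

theorem rmul_smul (r : k) (p : P) (t : M ⊗[k] P) : rmul (r • p) t = r • rmul p t := by
  induction t with
  | zero => simp
  | tmul a x => simp
  | add a b ha hb => simp only [map_add, ha, hb, smul_add]

theorem rmul_mul (p q : P) (t : M ⊗[k] P) : rmul (p * q) t = rmul q (rmul p t) := by
  induction t with
  | zero => simp
  | tmul a x => simp [mul_assoc]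
  | add a b ha hb => simp only [map_add, ha, hb]

/-- The right `P`-linear extension `x ⊗ p ↦ g x * p` of a linear map `g : X → M ⊗ P`. -/
def rext (g : X →ₗ[k] M ⊗[k] P) : X ⊗[k] P →ₗ[k] M ⊗[k] P :=
  TensorProduct.lift (LinearMap.mk₂ k (fun x p => rmul p (g x))
    (fun _ _ _ => by rw [map_add, map_add]) (fun _ _ _ => by rw [map_smul, map_smul])
    (fun _ _ _ => rmul_add _ _ _) (fun _ _ _ => rmul_smul _ _ _))

@[simp]
theorem rext_tmul (g : X →ₗ[k] M ⊗[k] P) (x : X) (p : P) :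
    rext g (x ⊗ₜ[k] p) = rmul p (g x) := rfl

theorem rext_rmul (g : X →ₗ[k] M ⊗[k] P) (p : P) (t : X ⊗[k] P) :
    rext g (rmul p t) = rmul p (rext g t) := by
  induction t with
  | zero => simp
  | tmul a x => simp [rmul_mul]
  | add a b ha hb => simp only [map_add, ha, hb]

theorem lTensor_smul_left (f : X →ₗ[k] Y) (p : P) (t : P ⊗[k] X) :
    f.lTensor P (p • t) = p • f.lTensor P t := by
  induction t with
  | zero => simp
  | tmul a x => simp [TensorProduct.smul_tmul']
  | add a b ha hb => simp only [smul_add, map_add, ha, hb]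

theorem assoc_smul_left (p : P) (t : (P ⊗[k] X) ⊗[k] Y) :
    TensorProduct.assoc k P X Y (p • t) = p • TensorProduct.assoc k P X Y t := by
  induction t with
  | zero => simp
  | tmul a x =>
    induction a with
    | zero => simp
    | tmul a y => simp [TensorProduct.smul_tmul']
    | add a b ha hb => simp only [smul_add, TensorProduct.add_tmul, map_add, ha, hb]
  | add a b ha hb => simp only [smul_add, map_add, ha, hb]

theorem rTensor_rmul (f : X →ₗ[k] Y) (p : P) (t : X ⊗[k] P) :
    f.rTensor P (rmul p t) = rmul p (f.rTensor P t) := by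
  induction t with
  | zero => simp
  | tmul a x => simp
  | add a b ha hb => simp only [map_add, ha, hb]

theorem assoc_rmul (p : P) (t : (X ⊗[k] Y) ⊗[k] P) :
    TensorProduct.assoc k X Y P (rmul p t) =
      (rmul p).lTensor X (TensorProduct.assoc k X Y P t) := by
  induction t with
  | zero => simp
  | tmul a x =>
    induction a with
    | zero => simp
    | tmul a y => simp
    | add a b ha hb => simp only [TensorProduct.add_tmul, map_add, ha, hb]
  | add a b ha hb => simp only [map_add, ha, hb]

theorem rid_smul_left (f : X →ₗ[k] k) (p : P)
    (t : P ⊗[k] X) :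
    TensorProduct.rid k P (f.lTensor P (p • t)) = p * TensorProduct.rid k P (f.lTensor P t) := by
  induction t with
  | zero => simp
  | tmul a c => simp [TensorProduct.smul_tmul']
  | add a b ha hb => simp only [smul_add, map_add, ha, hb, mul_add]

theorem lid_rmul (f : X →ₗ[k] k) (p : P) (t : X ⊗[k] P) :
    TensorProduct.lid k P (f.rTensor P (rmul p t)) = TensorProduct.lid k P (f.rTensor P t) * p := by
  induction t with
  | zero => simp
  | tmul a c => simp
  | add a b ha hb => simp only [map_add, ha, hb, add_mul]

theorem mul'_smul (p : P) (t : P ⊗[k] P) :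
    LinearMap.mul' k P (p • t) = p * LinearMap.mul' k P t := by
  induction t with
  | zero => simp
  | tmul x y => simp [TensorProduct.smul_tmul', mul_assoc]
  | add a b ha hb => simp only [smul_add, map_add, ha, hb, mul_add]

theorem mul'_rmul (p : P) (t : P ⊗[k] P) :
    LinearMap.mul' k P (rmul p t) = LinearMap.mul' k P t * p := by
  induction t with
  | zero => simp
  | tmul x y => simp [mul_assoc]
  | add a b ha hb => simp only [map_add, ha, hb, add_mul]

theorem rmul_one (t : M ⊗[k] P) : rmul 1 t = t := by
  induction t with
  | zero => simp
  | tmul x y => simp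
  | add a b ha hb => rw [map_add, ha, hb]

theorem rmul_smul_left (p y : P) (t : P ⊗[k] P) : rmul y (p • t) = p • rmul y t :=
  lTensor_smul_left _ _ _

variable {Q : Type*} [Ring Q] [Algebra k Q] (f : P →ₐ[k] Q)

theorem rTensor_algHom_smul (p : P) (t : P ⊗[k] X) :
    f.toLinearMap.rTensor X (p • t) = f p • f.toLinearMap.rTensor X t := by
  induction t with
  | zero => simp
  | tmul a x => simp [TensorProduct.smul_tmul']
  | add a b ha hb => simp only [smul_add, map_add, ha, hb]

theorem lTensor_algHom_rmul (p : P) (t : X ⊗[k] P) :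
    f.toLinearMap.lTensor X (rmul p t) = rmul (f p) (f.toLinearMap.lTensor X t) := by
  induction t with
  | zero => simp
  | tmul a x => simp
  | add a b ha hb => simp only [map_add, ha, hb]

theorem map_algHom_smul (g : X →ₗ[k] Y) (p : P) (t : P ⊗[k] X) :
    TensorProduct.map f.toLinearMap g (p • t) = f p • TensorProduct.map f.toLinearMap g t := by
  induction t with
  | zero => simp
  | tmul a x => simp [TensorProduct.smul_tmul']
  | add a b ha hb => simp only [smul_add, map_add, ha, hb]

theorem map_algHom_rmul (g : X →ₗ[k] Y) (p : P) (t : X ⊗[k] P) :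
    TensorProduct.map g f.toLinearMap (rmul p t) =
      rmul (f p) (TensorProduct.map g f.toLinearMap t) := by
  induction t with
  | zero => simp
  | tmul a x => simp
  | add a b ha hb => simp only [map_add, ha, hb]

end TensorActions

/-! ### Calculus of colinear maps. -/

section Colinear

variable {k : Type*} [Field k] {C : Type*} [AddCommGroup C] [Module k C]
variable {P : Type*} [Ring P] [Algebra k P]
variable {X : Type*} [AddCommGroup X] [Module k X] {Y : Type*} [AddCommGroup Y] [Module k Y]
variable {Z : Type*} [AddCommGroup Z] [Module k Z]

/-- Right colinearity of a linear map with respect to arbitrary maps `X → X ⊗ C`, `Y → Y ⊗ C`. -/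
def RColin (δ : X →ₗ[k] X ⊗[k] C) (δ' : Y →ₗ[k] Y ⊗[k] C) (g : X →ₗ[k] Y) : Prop :=
  δ' ∘ₗ g = g.rTensor C ∘ₗ δ

/-- Left colinearity of a linear map with respect to arbitrary maps `X → C ⊗ X`, `Y → C ⊗ Y`. -/
def LColin (δ : X →ₗ[k] C ⊗[k] X) (δ' : Y →ₗ[k] C ⊗[k] Y) (g : X →ₗ[k] Y) : Prop :=
  δ' ∘ₗ g = g.lTensor C ∘ₗ δ

theorem RColin.apply {δ : X →ₗ[k] X ⊗[k] C} {δ' : Y →ₗ[k] Y ⊗[k] C} {g : X →ₗ[k] Y}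
    (h : RColin δ δ' g) (x : X) : δ' (g x) = g.rTensor C (δ x) := LinearMap.congr_fun h x

theorem LColin.apply {δ : X →ₗ[k] C ⊗[k] X} {δ' : Y →ₗ[k] C ⊗[k] Y} {g : X →ₗ[k] Y}
    (h : LColin δ δ' g) (x : X) : δ' (g x) = g.lTensor C (δ x) := LinearMap.congr_fun h x

theorem RColin.comp {δ : X →ₗ[k] X ⊗[k] C} {δ' : Y →ₗ[k] Y ⊗[k] C} {δ'' : Z →ₗ[k] Z ⊗[k] C}
    {g' : Y →ₗ[k] Z} {g : X →ₗ[k] Y} (h' : RColin δ' δ'' g') (h : RColin δ δ' g) :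
    RColin δ δ'' (g' ∘ₗ g) := by
  refine LinearMap.ext fun x => ?_
  simp only [LinearMap.comp_apply, h'.apply, h.apply, LinearMap.rTensor_comp]

theorem LColin.comp {δ : X →ₗ[k] C ⊗[k] X} {δ' : Y →ₗ[k] C ⊗[k] Y} {δ'' : Z →ₗ[k] C ⊗[k] Z}
    {g' : Y →ₗ[k] Z} {g : X →ₗ[k] Y} (h' : LColin δ' δ'' g') (h : LColin δ δ' g) :
    LColin δ δ'' (g' ∘ₗ g) := by
  refine LinearMap.ext fun x => ?_
  simp only [LinearMap.comp_apply, h'.apply, h.apply, LinearMap.lTensor_comp]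

theorem RColin.add {δ : X →ₗ[k] X ⊗[k] C} {δ' : Y →ₗ[k] Y ⊗[k] C} {g g' : X →ₗ[k] Y}
    (h : RColin δ δ' g) (h' : RColin δ δ' g') : RColin δ δ' (g + g') := by
  refine LinearMap.ext fun x => ?_
  simp [h.apply, h'.apply, LinearMap.rTensor_add]

theorem RColin.sub {δ : X →ₗ[k] X ⊗[k] C} {δ' : Y →ₗ[k] Y ⊗[k] C} {g g' : X →ₗ[k] Y}
    (h : RColin δ δ' g) (h' : RColin δ δ' g') : RColin δ δ' (g - g') := by
  refine LinearMap.ext fun x => ?_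
  simp [h.apply, h'.apply, LinearMap.rTensor_sub]

theorem LColin.add {δ : X →ₗ[k] C ⊗[k] X} {δ' : Y →ₗ[k] C ⊗[k] Y} {g g' : X →ₗ[k] Y}
    (h : LColin δ δ' g) (h' : LColin δ δ' g') : LColin δ δ' (g + g') := by
  refine LinearMap.ext fun x => ?_
  simp [h.apply, h'.apply, LinearMap.lTensor_add]

theorem LColin.sub {δ : X →ₗ[k] C ⊗[k] X} {δ' : Y →ₗ[k] C ⊗[k] Y} {g g' : X →ₗ[k] Y}
    (h : LColin δ δ' g) (h' : LColin δ δ' g') : LColin δ δ' (g - g') := by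
  refine LinearMap.ext fun x => ?_
  simp [h.apply, h'.apply, LinearMap.lTensor_sub]

/-- A right colinear map that factors through a right colinear surjection. -/
theorem RColin.of_comp_surjective {δ : X →ₗ[k] X ⊗[k] C} {δ' : Y →ₗ[k] Y ⊗[k] C}
    {δ'' : Z →ₗ[k] Z ⊗[k] C} {g' : Y →ₗ[k] Z} {g : X →ₗ[k] Y} (h' : RColin δ δ'' (g' ∘ₗ g))
    (h : RColin δ δ' g) (hg : Function.Surjective g) : RColin δ' δ'' g' := by
  refine LinearMap.ext fun y => ?_
  obtain ⟨x, rfl⟩ := hg y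
  have := h'.apply x
  rw [LinearMap.rTensor_comp, LinearMap.comp_apply, LinearMap.comp_apply, ← h.apply] at this
  exact this

theorem LColin.of_comp_surjective {δ : X →ₗ[k] C ⊗[k] X} {δ' : Y →ₗ[k] C ⊗[k] Y}
    {δ'' : Z →ₗ[k] C ⊗[k] Z} {g' : Y →ₗ[k] Z} {g : X →ₗ[k] Y} (h' : LColin δ δ'' (g' ∘ₗ g))
    (h : LColin δ δ' g) (hg : Function.Surjective g) : LColin δ' δ'' g' := by
  refine LinearMap.ext fun y => ?_
  obtain ⟨x, rfl⟩ := hg y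
  have := h'.apply x
  rw [LinearMap.lTensor_comp, LinearMap.comp_apply, LinearMap.comp_apply, ← h.apply] at this
  exact this

/-- A colinear map composed with a colinear injection was colinear. -/
theorem RColin.of_comp_injective {δ : X →ₗ[k] X ⊗[k] C} {δ' : Y →ₗ[k] Y ⊗[k] C}
    {δ'' : Z →ₗ[k] Z ⊗[k] C} {g' : Y →ₗ[k] Z} {g : X →ₗ[k] Y} (h : RColin δ δ'' (g' ∘ₗ g))
    (h' : RColin δ' δ'' g') (hg : Function.Injective g') : RColin δ δ' g := by
  refine LinearMap.ext fun x => ?_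
  apply Module.Flat.rTensor_preserves_injective_linearMap (M := C) g' hg
  have := h.apply x
  rw [LinearMap.rTensor_comp, LinearMap.comp_apply, LinearMap.comp_apply] at this
  rw [LinearMap.comp_apply, ← h'.apply, this]; rfl

/-- The right coaction on the last leg. -/
def lastCoaction (P : Type*) [Ring P] [Algebra k P] (δ : X →ₗ[k] X ⊗[k] C) :
    P ⊗[k] X →ₗ[k] (P ⊗[k] X) ⊗[k] C :=
  (TensorProduct.assoc k P X C).symm.toLinearMap ∘ₗ δ.lTensor P

/-- The left coaction on the first leg. -/
def firstCoaction (P : Type*) [Ring P] [Algebra k P] (δ : X →ₗ[k] C ⊗[k] X) :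
    X ⊗[k] P →ₗ[k] C ⊗[k] (X ⊗[k] P) :=
  (TensorProduct.assoc k C X P).toLinearMap ∘ₗ δ.rTensor P

theorem lastCoaction_tmul (δ : X →ₗ[k] X ⊗[k] C) (p : P) (x : X) :
    lastCoaction P δ (p ⊗ₜ x) = (TensorProduct.assoc k P X C).symm (p ⊗ₜ δ x) := rfl

theorem firstCoaction_tmul (δ : X →ₗ[k] C ⊗[k] X) (p : P) (x : X) :
    firstCoaction P δ (x ⊗ₜ p) = (TensorProduct.assoc k C X P) (δ x ⊗ₜ p) := rfl

theorem assoc_symm_smul_left (p : P) (t : P ⊗[k] (X ⊗[k] Y)) :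
    (TensorProduct.assoc k P X Y).symm (p • t) = p • (TensorProduct.assoc k P X Y).symm t := by
  rw [LinearEquiv.symm_apply_eq, assoc_smul_left, LinearEquiv.apply_symm_apply]

theorem lastCoaction_smul (δ : X →ₗ[k] X ⊗[k] C) (p : P) (t : P ⊗[k] X) :
    lastCoaction P δ (p • t) = p • lastCoaction P δ t := by
  simp [lastCoaction, lTensor_smul_left, assoc_symm_smul_left]

theorem firstCoaction_rmul (δ : X →ₗ[k] C ⊗[k] X) (p : P) (t : X ⊗[k] P) :
    firstCoaction P δ (rmul p t) = (rmul p).lTensor C (firstCoaction P δ t) := by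
  simp [firstCoaction, rTensor_rmul, assoc_rmul]

theorem RColin.sext {δ : X →ₗ[k] X ⊗[k] C} {δ' : Y →ₗ[k] Y ⊗[k] C} {g : X →ₗ[k] P ⊗[k] Y}
    (h : RColin δ (lastCoaction P δ') g) :
    RColin (lastCoaction P δ) (lastCoaction P δ') (sext g) := by
  refine TensorProduct.ext' fun p x => ?_
  simp only [LinearMap.comp_apply, sext_tmul, lastCoaction_smul, h.apply, lastCoaction_tmul]
  induction δ x with
  | zero => simp
  | tmul y c => simp [TensorProduct.smul_tmul']
  | add a b ha hb => simp only [TensorProduct.tmul_add, map_add, smul_add, ha, hb]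

theorem LColin.rext {δ : X →ₗ[k] C ⊗[k] X} {δ' : Y →ₗ[k] C ⊗[k] Y} {g : X →ₗ[k] Y ⊗[k] P}
    (h : LColin δ (firstCoaction P δ') g) :
    LColin (firstCoaction P δ) (firstCoaction P δ') (rext g) := by
  refine TensorProduct.ext' fun x p => ?_
  simp only [LinearMap.comp_apply, rext_tmul, firstCoaction_rmul, h.apply, firstCoaction_tmul]
  induction δ x with
  | zero => simp
  | tmul c y => simp
  | add a b ha hb => simp only [TensorProduct.add_tmul, map_add, ha, hb]

theorem RColin.map {Q : Type*} [Ring Q] [Algebra k Q] (f : P →ₗ[k] Q)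
    {δ : X →ₗ[k] X ⊗[k] C} {δ' : Y →ₗ[k] Y ⊗[k] C} {g : X →ₗ[k] Y} (h : RColin δ δ' g) :
    RColin (lastCoaction P δ) (lastCoaction Q δ') (TensorProduct.map f g) := by
  refine TensorProduct.ext' fun p x => ?_
  simp only [LinearMap.comp_apply, TensorProduct.map_tmul, lastCoaction_tmul, h.apply]
  induction δ x with
  | zero => simp
  | tmul y c => simp
  | add a b ha hb => simp only [TensorProduct.tmul_add, map_add, ha, hb]

theorem LColin.map {Q : Type*} [Ring Q] [Algebra k Q] (f : P →ₗ[k] Q)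
    {δ : X →ₗ[k] C ⊗[k] X} {δ' : Y →ₗ[k] C ⊗[k] Y} {g : X →ₗ[k] Y} (h : LColin δ δ' g) :
    LColin (firstCoaction P δ) (firstCoaction Q δ') (TensorProduct.map g f) := by
  refine TensorProduct.ext' fun x p => ?_
  simp only [LinearMap.comp_apply, TensorProduct.map_tmul, firstCoaction_tmul, h.apply]
  induction δ x with
  | zero => simp
  | tmul c y => simp
  | add a b ha hb => simp only [TensorProduct.add_tmul, map_add, ha, hb]

end Colinear

end CoaugCoactions

namespace CoaugCoactions

variable {k : Type*} [Field k] {C : Type*} [AddCommGroup C] [Module k C] [Coalgebra k C] {e : C}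
variable {P : Type*} [Ring P] [Algebra k P] (D : CoaugCoactions k e P)

local notation "Δ" => (Coalgebra.comul (R := k) (A := C))
local notation "ε" => (Coalgebra.counit (R := k) (A := C))

/-! ### Lifted canonical maps and strong connections. -/

section Basic

theorem right_rColin : RColin D.right (lastCoaction P Δ) D.right := by
  rw [RColin, lastCoaction, LinearMap.comp_assoc, ← D.right_coassoc]
  ext x; simp

theorem left_lColin : LColin D.left (firstCoaction P Δ) D.left := by
  rw [LColin, firstCoaction, LinearMap.comp_assoc, D.left_coassoc]

@[simp]
theorem canLift_tmul (x y : P) : D.canLift (x ⊗ₜ y) = x • D.right y := rfl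

theorem canLift_smul (p : P) (t : P ⊗[k] P) : D.canLift (p • t) = p • D.canLift t :=
  sext_smul _ _ _

/-- The lifted left canonical map `P ⊗ P → C ⊗ P`, `x ⊗ y ↦ _PΔ(x) y`. -/
def canLiftL : P ⊗[k] P →ₗ[k] C ⊗[k] P := rext D.left

@[simp]
theorem canLiftL_tmul (x y : P) : D.canLiftL (x ⊗ₜ y) = rmul y (D.left x) := rfl

theorem canLift_rColin : RColin (lastCoaction P D.right) (lastCoaction P Δ) D.canLift :=
  D.right_rColin.sext

theorem canLiftL_lColin : LColin (firstCoaction P D.left) (firstCoaction P Δ) D.canLiftL :=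
  D.left_lColin.rext

/-- With the coaction isolated from the product, right colinearity of a map into P ⊗ P can be
applied inside can. -/
theorem canLift_eq_mul (t : P ⊗[k] P) :
    D.canLift t = (LinearMap.mul' k P).rTensor C (lastCoaction P D.right t) := by
  induction t with
  | zero => simp
  | tmul x y =>
    rw [canLift_tmul, lastCoaction_tmul]
    induction D.right y with
    | zero => simp
    | tmul p c => simp [TensorProduct.smul_tmul']
    | add a b ha hb => simp only [TensorProduct.tmul_add, map_add, smul_add, ha, hb]
  | add a b ha hb => simp only [map_add, ha, hb]

theorem canLiftL_eq_mul (t : P ⊗[k] P) :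
    D.canLiftL t = (LinearMap.mul' k P).lTensor C (firstCoaction P D.left t) := by
  induction t with
  | zero => simp
  | tmul x y =>
    rw [canLiftL_tmul, firstCoaction_tmul]
    induction D.left x with
    | zero => simp
    | tmul p c => simp
    | add a b ha hb => simp only [TensorProduct.add_tmul, map_add, ha, hb]
  | add a b ha hb => simp only [map_add, ha, hb]

theorem right_counit_apply (p : P) : TensorProduct.rid k P ((ε).lTensor P (D.right p)) = p :=
  LinearMap.congr_fun D.right_counit p

theorem left_counit_apply (p : P) : TensorProduct.lid k P ((ε).rTensor P (D.left p)) = p :=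
  LinearMap.congr_fun D.left_counit p

theorem rid_canLift (t : P ⊗[k] P) :
    TensorProduct.rid k P ((ε).lTensor P (D.canLift t)) = LinearMap.mul' k P t := by
  induction t with
  | zero => simp
  | tmul x y => rw [canLift_tmul, rid_smul_left, right_counit_apply]; rfl
  | add a b ha hb => simp only [map_add, ha, hb]

theorem lid_canLiftL (t : P ⊗[k] P) :
    TensorProduct.lid k P ((ε).rTensor P (D.canLiftL t)) = LinearMap.mul' k P t := by
  induction t with
  | zero => simp
  | tmul x y => rw [canLiftL_tmul, lid_rmul, left_counit_apply]; rfl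
  | add a b ha hb => simp only [map_add, ha, hb]

theorem right_of_mem_coinv {b : P} (hb : b ∈ D.coinv) : D.right b = b ⊗ₜ e := by
  have := hb 1
  rwa [mul_one, D.right_one, TensorProduct.smul_tmul', smul_eq_mul, mul_one] at this

/-- A linear map `C → P ⊗ P` that splits the multiplication and is bicolinear; it is not required
to be unital. -/
structure StrongConnection (l : C →ₗ[k] P ⊗[k] P) : Prop where
  mul : ∀ c, LinearMap.mul' k P (l c) = algebraMap k P (ε c)
  rColin : RColin Δ (lastCoaction P D.right) l
  lColin : LColin Δ (firstCoaction P D.left) l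

variable {D}

/-- Colinearity rewrites the left side as mul(l(c₁)) ⊗ c₂ = ε(c₁) ⊗ c₂, and the counit axiom
finishes. -/
theorem canLift_of_rColin {l : C →ₗ[k] P ⊗[k] P}
    (hm : ∀ c, LinearMap.mul' k P (l c) = algebraMap k P (ε c))
    (hr : RColin Δ (lastCoaction P D.right) l) (c : C) : D.canLift (l c) = 1 ⊗ₜ c := by
  have h : LinearMap.mul' k P ∘ₗ l = Algebra.linearMap k P ∘ₗ ε := LinearMap.ext hm
  rw [canLift_eq_mul, hr.apply, ← LinearMap.comp_apply, ← LinearMap.rTensor_comp, h,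
    LinearMap.rTensor_comp, LinearMap.comp_apply, Coalgebra.rTensor_counit_comul]
  simp

theorem StrongConnection.canLift {l : C →ₗ[k] P ⊗[k] P} (hl : D.StrongConnection l) (c : C) :
    D.canLift (l c) = 1 ⊗ₜ c := canLift_of_rColin hl.mul hl.rColin c

theorem StrongConnection.canLiftL {l : C →ₗ[k] P ⊗[k] P} (hl : D.StrongConnection l) (c : C) :
    D.canLiftL (l c) = c ⊗ₜ 1 := by
  have h : LinearMap.mul' k P ∘ₗ l = Algebra.linearMap k P ∘ₗ ε := LinearMap.ext hl.mul
  rw [canLiftL_eq_mul, hl.lColin.apply, ← LinearMap.comp_apply, ← LinearMap.lTensor_comp, h,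
    LinearMap.lTensor_comp, LinearMap.comp_apply, Coalgebra.lTensor_counit_comul]
  simp

theorem mul'_sext {l : C →ₗ[k] P ⊗[k] P}
    (hm : ∀ c, LinearMap.mul' k P (l c) = algebraMap k P (ε c)) (w : P ⊗[k] C) :
    LinearMap.mul' k P (sext l w) = TensorProduct.rid k P ((ε).lTensor P w) := by
  induction w with
  | zero => simp
  | tmul x y => simp [mul'_smul, hm, Algebra.smul_def, Algebra.commutes]
  | add a b ha hb => simp only [map_add, ha, hb]

theorem mul'_rext {l : C →ₗ[k] P ⊗[k] P}
    (hm : ∀ c, LinearMap.mul' k P (l c) = algebraMap k P (ε c)) (w : C ⊗[k] P) :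
    LinearMap.mul' k P (rext l w) = TensorProduct.lid k P ((ε).rTensor P w) := by
  induction w with
  | zero => simp
  | tmul x y => simp [mul'_rmul, hm, Algebra.smul_def]
  | add a b ha hb => simp only [map_add, ha, hb]

end Basic

/-! ### The canonical entwining and the product. -/

section Entwining

variable {D} (h : Function.Bijective D.can)

variable (D) in
theorem canLift_surjective (h : Function.Bijective D.can) : Function.Surjective D.canLift := by
  intro w
  obtain ⟨t, rfl⟩ := h.2 w
  obtain ⟨t, rfl⟩ := Submodule.Quotient.mk_surjective _ t
  exact ⟨t, rfl⟩

theorem can_symm_canLift (t : P ⊗[k] P) :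
    (LinearEquiv.ofBijective D.can h).symm (D.canLift t) = Submodule.Quotient.mk t := by
  rw [LinearEquiv.symm_apply_eq]; rfl

/-- Right multiplication by `y` on `P ⊗ C`, transported along the canonical map. -/
noncomputable def canMul (y : P) : P ⊗[k] C →ₗ[k] P ⊗[k] C :=
  D.can ∘ₗ D.balMulRight y ∘ₗ (LinearEquiv.ofBijective D.can h).symm.toLinearMap

theorem canMul_canLift (y : P) (t : P ⊗[k] P) :
    canMul h y (D.canLift t) = D.canLift (rmul y t) := by
  simp only [canMul, LinearMap.comp_apply, LinearEquiv.coe_coe, can_symm_canLift]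
  rfl

theorem canMul_smul (y p : P) (w : P ⊗[k] C) : canMul h y (p • w) = p • canMul h y w := by
  obtain ⟨t, rfl⟩ := D.canLift_surjective h w
  rw [← canLift_smul, canMul_canLift, canMul_canLift, rmul_smul_left, canLift_smul]

theorem canMul_one_tmul (y : P) (c : C) : canMul h y (1 ⊗ₜ c) = D.entwining h (c ⊗ₜ y) := rfl

theorem canMul_tmul (p y : P) (c : C) :
    canMul h y (p ⊗ₜ c) = p • D.entwining h (c ⊗ₜ y) := by
  rw [← canMul_one_tmul, ← canMul_smul, TensorProduct.smul_tmul', smul_eq_mul, mul_one]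

/-- This stands in for multiplicativity of the coaction: Δ(py) depends only on Δ(p) and y, since
Δ(p) is the image of 1 ⊗ p under the lifted canonical map. -/
theorem canMul_right (y p : P) : canMul h y (D.right p) = D.right (p * y) := by
  simpa using canMul_canLift h y (1 ⊗ₜ p)

theorem canMul_tmul_e (p y : P) : canMul h y (p ⊗ₜ e) = p • D.right y := by
  simpa [D.right_one, TensorProduct.smul_tmul'] using canMul_canLift h y (p ⊗ₜ 1)

theorem canMul_mul (y z : P) (w : P ⊗[k] C) :
    canMul h (y * z) w = canMul h z (canMul h y w) := by
  obtain ⟨t, rfl⟩ := D.canLift_surjective h w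
  rw [canMul_canLift, canMul_canLift, canMul_canLift, rmul_mul]

theorem entwining_rmul (y : P) (v : C ⊗[k] P) :
    D.entwining h (rmul y v) = canMul h y (D.entwining h v) := by
  induction v with
  | zero => simp
  | tmul c p => rw [rmul_tmul, ← canMul_one_tmul, canMul_mul, canMul_one_tmul]
  | add a b ha hb => simp only [map_add, ha, hb]

theorem entwining_one (c : C) : D.entwining h (c ⊗ₜ 1) = 1 ⊗ₜ c := by
  obtain ⟨t, ht⟩ := D.canLift_surjective h (1 ⊗ₜ c)
  rw [← canMul_one_tmul, ← ht, canMul_canLift]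
  rw [rmul_one]

/-- Since Δ(bp) is determined by Δ(b) and p, the defining condition need only be tested at p = 1. -/
theorem mem_coinv_iff (h : Function.Bijective D.can) {b : P} :
    b ∈ D.coinv ↔ D.right b = b ⊗ₜ e := by
  refine ⟨D.right_of_mem_coinv, fun hb p => ?_⟩
  rw [← canMul_right h, hb, canMul_tmul_e]

variable (hleft : ∀ p, D.entwining h (D.left p) = p ⊗ₜ[k] e)
include hleft

theorem entwining_canLiftL (t : P ⊗[k] P) : D.entwining h (D.canLiftL t) = D.canLift t := by
  induction t with
  | zero => simp
  | tmul x y => rw [canLiftL_tmul, entwining_rmul, hleft, canMul_tmul_e]; rfl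
  | add a b ha hb => simp only [map_add, ha, hb]

/-- The injective map ψ sends both sides to xb ⊗ e. -/
theorem left_mul_coinv (hψ : Function.Injective (D.entwining h)) (x : P) {b : P}
    (hb : b ∈ D.coinv) : D.left (x * b) = rmul b (D.left x) := by
  apply hψ
  rw [hleft, ← canLiftL_tmul, entwining_canLiftL h hleft, canLift_tmul,
    D.right_of_mem_coinv hb, TensorProduct.smul_tmul', smul_eq_mul]

end Entwining

/-! ### Tensors with a coinvariant leg. -/

section CoinvTensor

/-- The image of `B ⊗ P` in `P ⊗ P`. -/
abbrev coinvTensor : Submodule k (P ⊗[k] P) :=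
  LinearMap.range (D.coinv.val.toLinearMap.rTensor P)

/-- The image of `P ⊗ B` in `P ⊗ P`. -/
abbrev tensorCoinv : Submodule k (P ⊗[k] P) :=
  LinearMap.range (D.coinv.val.toLinearMap.lTensor P)

variable (k P) in
/-- The trivial right coaction `x ↦ x ⊗ e`. -/
def trivCoaction (e : C) : P →ₗ[k] P ⊗[k] C := (TensorProduct.mk k P C).flip e

omit [Coalgebra k C] in
@[simp]
theorem trivCoaction_apply (e : C) (x : P) : trivCoaction k P e x = x ⊗ₜ e := rfl

variable {D}

/-- Exhibiting B as the kernel of x ↦ Δ(x) - x ⊗ e lets flatness detect B ⊗ P and P ⊗ B by one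
equation in each case. -/
theorem exact_coinv (hB : ∀ b, D.right b = b ⊗ₜ e → b ∈ D.coinv) :
    Function.Exact D.coinv.val.toLinearMap (D.right - trivCoaction k P e) := by
  intro x
  rw [LinearMap.sub_apply, sub_eq_zero, trivCoaction_apply]
  refine ⟨fun hx => ⟨⟨x, hB x hx⟩, rfl⟩, ?_⟩
  rintro ⟨b, rfl⟩
  exact D.right_of_mem_coinv b.2

theorem mem_coinvTensor (hB : ∀ b, D.right b = b ⊗ₜ e → b ∈ D.coinv) {t : P ⊗[k] P}
    (ht : D.right.rTensor P t = (trivCoaction k P e).rTensor P t) : t ∈ D.coinvTensor := by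
  refine (Module.Flat.rTensor_exact P (exact_coinv hB) t).1 ?_
  rw [LinearMap.rTensor_sub]
  exact sub_eq_zero.2 ht

theorem mem_tensorCoinv (hB : ∀ b, D.right b = b ⊗ₜ e → b ∈ D.coinv) {t : P ⊗[k] P}
    (ht : D.right.lTensor P t = (trivCoaction k P e).lTensor P t) : t ∈ D.tensorCoinv := by
  refine (Module.Flat.lTensor_exact P (exact_coinv hB) t).1 ?_
  rw [LinearMap.lTensor_sub]
  exact sub_eq_zero.2 ht

theorem rTensor_right_of_mem {t : P ⊗[k] P} (ht : t ∈ D.coinvTensor) :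
    D.right.rTensor P t = (trivCoaction k P e).rTensor P t := by
  obtain ⟨u, rfl⟩ := ht
  induction u with
  | zero => simp
  | tmul b x => simp [D.right_of_mem_coinv b.2]
  | add a b ha hb => simp only [map_add, ha, hb]

end CoinvTensor

/-! ### Coinvariance and colinearity of translated tensors. -/

section Translation

variable {D} (h : Function.Bijective D.can)

/-- The underlying formula is Δ(px) = p₀ ψ(p₁ ⊗ x), applied with x the first leg of N(c). -/
theorem rTensor_right_smul_tmul (N : C →ₗ[k] P ⊗[k] P) (p : P) (c : C) :
    D.right.rTensor P (p • N c) =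
      sext ((D.entwining h).rTensor P ∘ₗ (TensorProduct.assoc k C P P).symm.toLinearMap ∘ₗ
        N.lTensor C) (TensorProduct.assoc k P C C (D.right p ⊗ₜ c)) := by
  -- Treating N(c) as an independent tensor t makes separate inductions on t and on Δ(p) possible.
  set Ξ : P ⊗[k] P → (P ⊗[k] C →ₗ[k] (P ⊗[k] C) ⊗[k] P) := fun t =>
    sext ((D.entwining h).rTensor P ∘ₗ (TensorProduct.assoc k C P P).symm.toLinearMap ∘ₗ
      (TensorProduct.mk k C (P ⊗[k] P)).flip t) with hΞ
  have key : ∀ (w : P ⊗[k] C) (x y : P), canMul h x w ⊗ₜ[k] y = Ξ (x ⊗ₜ y) w := by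
    intro w x y
    induction w with
    | zero => simp
    | tmul a c => simp [hΞ, canMul_tmul, TensorProduct.smul_tmul']
    | add a b ha hb => simp only [TensorProduct.add_tmul, map_add, ha, hb]
  have key2 : ∀ w : P ⊗[k] C,
      sext ((D.entwining h).rTensor P ∘ₗ (TensorProduct.assoc k C P P).symm.toLinearMap ∘ₗ
        N.lTensor C) (TensorProduct.assoc k P C C (w ⊗ₜ c)) = Ξ (N c) w := by
    intro w
    induction w with
    | zero => simp
    | tmul a c => simp [hΞ]
    | add a b ha hb => simp only [TensorProduct.add_tmul, map_add, ha, hb]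
  have key3 : ∀ (w : P ⊗[k] C) (s t : P ⊗[k] P), Ξ (s + t) w = Ξ s w + Ξ t w := by
    intro w s t
    induction w with
    | zero => simp
    | tmul a c => simp [hΞ]
    | add a b ha hb => simp only [map_add, ha, hb]; abel
  rw [key2]
  induction N c with
  | zero =>
    rw [smul_zero, map_zero]
    induction D.right p with
    | zero => simp
    | tmul a c => simp [hΞ]
    | add a b ha hb => rw [map_add, ← ha, ← hb, add_zero]
  | tmul x y =>
    rw [← key, canMul_right, TensorProduct.smul_tmul', LinearMap.rTensor_tmul, smul_eq_mul]
  | add a b ha hb => rw [smul_add, map_add, ha, hb, key3]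

/-- `p ↦ p₀ N(p₁)` takes values in `B ⊗ P` when `N` is left colinear. -/
theorem sext_right_mem (h : Function.Bijective D.can)
    (hleft : ∀ p, D.entwining h (D.left p) = p ⊗ₜ[k] e) {N : C →ₗ[k] P ⊗[k] P}
    (hN : LColin Δ (firstCoaction P D.left) N) (p : P) :
    sext N (D.right p) ∈ D.coinvTensor := by
  apply mem_coinvTensor fun b => (mem_coinv_iff h).2
  set κ := (D.entwining h).rTensor P ∘ₗ (TensorProduct.assoc k C P P).symm.toLinearMap ∘ₗ
        N.lTensor C with hκ
  have h1 : ∀ w : P ⊗[k] C, D.right.rTensor P (sext N w) =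
      sext κ (TensorProduct.assoc k P C C (D.right.rTensor C w)) := by
    intro w
    induction w with
    | zero => simp
    | tmul a c => exact rTensor_right_smul_tmul h N a c
    | add a b ha hb => simp only [map_add, ha, hb]
  have h2 : TensorProduct.assoc k P C C (D.right.rTensor C (D.right p)) =
      (Δ).lTensor P (D.right p) := LinearMap.congr_fun D.right_coassoc p
  -- Left colinearity identifies c₁ ⊗ N(c₂) with the left coaction on the first leg of N(c), and ψ
  -- turns that coaction into x ↦ x ⊗ e.
  have h3 : ∀ c, κ (Δ c) = (trivCoaction k P e).rTensor P (N c) := by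
    intro c
    have : D.left.rTensor P (N c) = (TensorProduct.assoc k C P P).symm (N.lTensor C (Δ c)) := by
      rw [← hN.apply]; simp [firstCoaction]
    rw [hκ, LinearMap.comp_apply, LinearMap.comp_apply, LinearEquiv.coe_coe, ← this,
      ← LinearMap.comp_apply, ← LinearMap.rTensor_comp]
    congr 2
    exact LinearMap.ext hleft
  rw [h1, h2]
  induction D.right p with
  | zero => simp
  | tmul a c =>
    rw [LinearMap.lTensor_tmul, sext_tmul, sext_tmul, h3]
    induction N c with
    | zero => simp
    | tmul x y => simp [TensorProduct.smul_tmul']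
    | add a b ha hb => simp only [map_add, smul_add, ha, hb]
  | add a b ha hb => simp only [map_add, ha, hb]

/-- `p ↦ N(p₋₁) p₀` takes values in `P ⊗ B` when `N` is right colinear. -/
theorem rext_left_mem (h : Function.Bijective D.can)
    (hleft : ∀ p, D.entwining h (D.left p) = p ⊗ₜ[k] e) {N : C →ₗ[k] P ⊗[k] P}
    (hN : RColin Δ (lastCoaction P D.right) N) (p : P) :
    rext N (D.left p) ∈ D.tensorCoinv := by
  apply mem_tensorCoinv fun b => (mem_coinv_iff h).2
  -- `Θ ((x ⊗ y) ⊗ w) = x ⊗ y • w`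
  set Θ : (P ⊗[k] P) ⊗[k] (P ⊗[k] C) →ₗ[k] P ⊗[k] (P ⊗[k] C) :=
    (sext (LinearMap.id : P ⊗[k] C →ₗ[k] P ⊗[k] C)).lTensor P ∘ₗ
      (TensorProduct.assoc k P P (P ⊗[k] C)).toLinearMap with hΘ
  -- Right colinearity moves the coaction of the second leg onto c₂, so that multiplying by z
  -- afterwards produces ψ(c₂ ⊗ z).
  have hc : ∀ z c, D.right.lTensor P (rmul z (N c)) =
      Θ (TensorProduct.map N (D.entwining h) (TensorProduct.assoc k C C P (Δ c ⊗ₜ z))) := by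
    intro z c
    have h1 : D.right.lTensor P (N c) = TensorProduct.assoc k P P C (N.rTensor C (Δ c)) := by
      rw [← hN.apply]; simp [lastCoaction]
    have h2 : ∀ t : P ⊗[k] P, D.right.lTensor P (rmul z t) =
        (canMul h z).lTensor P (D.right.lTensor P t) := by
      intro t
      induction t with
      | zero => simp
      | tmul x y => simp [canMul_right]
      | add a b ha hb => simp only [map_add, ha, hb]
    rw [h2, h1]
    induction Δ c with
    | zero => simp
    | tmul c d =>
      simp only [LinearMap.rTensor_tmul, TensorProduct.assoc_tmul, TensorProduct.map_tmul]
      induction N c with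
      | zero => simp
      | tmul x y => simp [hΘ, canMul_tmul]
      | add a b ha hb => simp only [TensorProduct.add_tmul, map_add, ha, hb]
    | add a b ha hb => simp only [TensorProduct.add_tmul, map_add, ha, hb]
  have h1 : ∀ v : C ⊗[k] P, D.right.lTensor P (rext N v) =
      Θ (TensorProduct.map N (D.entwining h) (TensorProduct.assoc k C C P ((Δ).rTensor P v))) := by
    intro v
    induction v with
    | zero => simp
    | tmul c z => exact hc z c
    | add a b ha hb => simp only [map_add, ha, hb]
  -- Coassociativity puts a left coaction under ψ, where `hleft` yields z ⊗ e.
  have h2 : TensorProduct.assoc k C C P ((Δ).rTensor P (D.left p)) = D.left.lTensor C (D.left p) :=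
    (LinearMap.congr_fun D.left_coassoc p).symm
  rw [h1, h2]
  induction D.left p with
  | zero => simp
  | tmul c z =>
    rw [LinearMap.lTensor_tmul, TensorProduct.map_tmul, hleft, rext_tmul]
    induction N c with
    | zero => simp
    | tmul x y => simp [hΘ, TensorProduct.smul_tmul']
    | add a b ha hb => simp only [TensorProduct.add_tmul, map_add, ha, hb]
  | add a b ha hb => simp only [map_add, ha, hb]

/-- `x ⊗ y ↦ x s(y)` is left colinear when `s` takes values in `B ⊗ P`. -/
theorem sext_lColin (h : Function.Bijective D.can)
    (hψ : Function.Injective (D.entwining h))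
    (hleft : ∀ p, D.entwining h (D.left p) = p ⊗ₜ[k] e) {s : P →ₗ[k] P ⊗[k] P}
    (hs : ∀ p, s p ∈ D.coinvTensor) :
    LColin (firstCoaction P D.left) (firstCoaction P D.left) (sext s) := by
  refine TensorProduct.ext' fun x y => ?_
  -- The coinvariant leg of u multiplies x from the right, and `left_mul_coinv` takes it out of the
  -- left coaction.
  have key : ∀ u ∈ D.coinvTensor, ∀ (f : P →ₗ[k] P ⊗[k] P), (∀ x, f x = x • u) →
      firstCoaction P D.left (x • u) = f.lTensor C (D.left x) := by
    rintro _ ⟨u, rfl⟩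
    induction u with
    | zero =>
      intro f hf
      have : f = 0 := LinearMap.ext fun x => by simp [hf]
      simp [this]
    | tmul b z =>
      intro f hf
      rw [LinearMap.rTensor_tmul, TensorProduct.smul_tmul', firstCoaction_tmul]
      have hb : D.left (x • (b : P)) = rmul (b : P) (D.left x) :=
        left_mul_coinv h hleft hψ x b.2
      rw [show D.coinv.val.toLinearMap b = (b : P) from rfl, hb]
      induction D.left x with
      | zero => simp
      | tmul c y => simp [hf, TensorProduct.smul_tmul']
      | add a b ha hb => simp only [TensorProduct.add_tmul, map_add, ha, hb]
    | add a b ha hb =>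
      intro f hf
      have hlin : ∀ u : P ⊗[k] P, ∃ g : P →ₗ[k] P ⊗[k] P, ∀ x, g x = x • u := fun u =>
        ⟨sext (LinearMap.id : P ⊗[k] P →ₗ[k] P ⊗[k] P) ∘ₗ (TensorProduct.mk k P _).flip u,
          fun x => rfl⟩
      obtain ⟨g, hg⟩ := hlin (D.coinv.val.toLinearMap.rTensor P a)
      obtain ⟨g', hg'⟩ := hlin (D.coinv.val.toLinearMap.rTensor P b)
      have : f = g + g' := LinearMap.ext fun x => by
        rw [hf, LinearMap.add_apply, hg, hg', map_add, smul_add]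
      rw [map_add, smul_add, map_add, ha g hg, hb g' hg', this, LinearMap.lTensor_add,
        LinearMap.add_apply]
  simp only [LinearMap.comp_apply, sext_tmul]
  rw [key _ (hs y) (sext s ∘ₗ (TensorProduct.mk k P P).flip y) (fun x => by simp),
    firstCoaction_tmul]
  induction D.left x with
  | zero => simp
  | tmul c y => simp
  | add a b ha hb => simp only [TensorProduct.add_tmul, map_add, ha, hb]

/-- `x ⊗ y ↦ x y₀ N(y₁)` is left colinear when `N` is. -/
theorem sext_canLift_lColin (h : Function.Bijective D.can)
    (hψ : Function.Injective (D.entwining h))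
    (hleft : ∀ p, D.entwining h (D.left p) = p ⊗ₜ[k] e) {N : C →ₗ[k] P ⊗[k] P}
    (hN : LColin Δ (firstCoaction P D.left) N) :
    LColin (firstCoaction P D.left) (firstCoaction P D.left) (sext N ∘ₗ D.canLift) := by
  have : sext N ∘ₗ D.canLift = sext (sext N ∘ₗ D.right) :=
    TensorProduct.ext' fun x y => by simp [sext_smul]
  rw [this]
  exact sext_lColin h hψ hleft (sext_right_mem h hleft hN)

/-- `x ⊗ y ↦ N(x₋₁) x₀ y` is right colinear when `N` is. -/
theorem rext_canLiftL_rColin (h : Function.Bijective D.can)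
    (hleft : ∀ p, D.entwining h (D.left p) = p ⊗ₜ[k] e) {N : C →ₗ[k] P ⊗[k] P}
    (hN : RColin Δ (lastCoaction P D.right) N) :
    RColin (lastCoaction P D.right) (lastCoaction P D.right) (rext N ∘ₗ D.canLiftL) := by
  refine TensorProduct.ext' fun x y => ?_
  have key : ∀ u ∈ D.tensorCoinv, ∀ (f : P →ₗ[k] P ⊗[k] P), (∀ y, f y = rmul y u) →
      lastCoaction P D.right (rmul y u) = f.rTensor C (D.right y) := by
    rintro _ ⟨u, rfl⟩
    induction u with
    | zero =>
      intro f hf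
      have : f = 0 := LinearMap.ext fun x => by simp [hf]
      simp [this]
    | tmul z b =>
      intro f hf
      rw [LinearMap.lTensor_tmul, rmul_tmul, lastCoaction_tmul]
      have hb : D.right ((b : P) * y) = (b : P) • D.right y := b.2 y
      rw [show D.coinv.val.toLinearMap b = (b : P) from rfl, hb]
      induction D.right y with
      | zero => simp
      | tmul c y => simp [hf, TensorProduct.smul_tmul']
      | add a b ha hb => simp only [TensorProduct.tmul_add, map_add, smul_add, ha, hb]
    | add a b ha hb =>
      intro f hf
      have hlin : ∀ u : P ⊗[k] P, ∃ g : P →ₗ[k] P ⊗[k] P, ∀ x, g x = rmul x u := fun u =>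
        ⟨rext (LinearMap.id : P ⊗[k] P →ₗ[k] P ⊗[k] P) ∘ₗ TensorProduct.mk k _ P u,
          fun x => rfl⟩
      obtain ⟨g, hg⟩ := hlin (D.coinv.val.toLinearMap.lTensor P a)
      obtain ⟨g', hg'⟩ := hlin (D.coinv.val.toLinearMap.lTensor P b)
      have : f = g + g' := LinearMap.ext fun x => by
        rw [hf, LinearMap.add_apply, hg, hg', map_add, map_add]
      rw [map_add, map_add, map_add, ha g hg, hb g' hg', this, LinearMap.rTensor_add,
        LinearMap.add_apply]
  simp only [LinearMap.comp_apply, canLiftL_tmul, rext_rmul]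
  rw [key _ (rext_left_mem h hleft hN x) ((rext N ∘ₗ D.canLiftL) ∘ₗ
    TensorProduct.mk k P P x) (fun x => by simp [rext_rmul]), lastCoaction_tmul]
  induction D.right y with
  | zero => simp
  | tmul c y => simp [rext_rmul]
  | add a b ha hb => simp only [TensorProduct.tmul_add, map_add, ha, hb]

/-- Correction of a bicolinear map `L` by a strong connection, on the left. -/
theorem StrongConnection.correct_left (h : Function.Bijective D.can)
    (hψ : Function.Injective (D.entwining h))
    (hleft : ∀ p, D.entwining h (D.left p) = p ⊗ₜ[k] e) {N L : C →ₗ[k] P ⊗[k] P}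
    (hN : D.StrongConnection N) (hr : RColin Δ (lastCoaction P D.right) L)
    (hl : LColin Δ (firstCoaction P D.left) L) :
    D.StrongConnection (L + N - sext N ∘ₗ D.canLift ∘ₗ L) where
  mul c := by
    simp only [LinearMap.sub_apply, LinearMap.add_apply, LinearMap.comp_apply, map_sub, map_add,
      mul'_sext hN.mul, rid_canLift, hN.mul]
    abel
  rColin := (hr.add hN.rColin).sub (hN.rColin.sext.comp (D.canLift_rColin.comp hr))
  lColin := (hl.add hN.lColin).sub ((sext_canLift_lColin h hψ hleft hN.lColin).comp hl)

/-- Correction of a bicolinear map `L` by a strong connection, on the right. -/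
theorem StrongConnection.correct_right (h : Function.Bijective D.can)
    (hleft : ∀ p, D.entwining h (D.left p) = p ⊗ₜ[k] e) {N L : C →ₗ[k] P ⊗[k] P}
    (hN : D.StrongConnection N) (hr : RColin Δ (lastCoaction P D.right) L)
    (hl : LColin Δ (firstCoaction P D.left) L) :
    D.StrongConnection (L + N - rext N ∘ₗ D.canLiftL ∘ₗ L) where
  mul c := by
    simp only [LinearMap.sub_apply, LinearMap.add_apply, LinearMap.comp_apply, map_sub, map_add,
      mul'_rext hN.mul, lid_canLiftL, hN.mul]
    abel
  rColin := (hr.add hN.rColin).sub ((rext_canLiftL_rColin h hleft hN.rColin).comp hr)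
  lColin := (hl.add hN.lColin).sub (hN.lColin.rext.comp (D.canLiftL_lColin.comp hl))

end Translation

/-! ### Principality in terms of strong connections. -/

section Criterion

/-- `c ⊗ p ↦ l(c)⁽¹⁾ Δ(l(c)⁽²⁾ p)`, the entwining described by a strong connection `l`. -/
def psi (l : C →ₗ[k] P ⊗[k] P) : C ⊗[k] P →ₗ[k] P ⊗[k] C := D.canLift ∘ₗ rext l

/-- `p ⊗ c ↦ _PΔ(p l(c)⁽¹⁾) l(c)⁽²⁾`, the inverse entwining described by a strong connection. -/
def chi (l : C →ₗ[k] P ⊗[k] P) : P ⊗[k] C →ₗ[k] C ⊗[k] P := D.canLiftL ∘ₗ sext l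

/-- Data on a linear map `C → P ⊗ P` that suffice for principality. -/
structure PrincipalData (l : C →ₗ[k] P ⊗[k] P) : Prop where
  mul : ∀ c, LinearMap.mul' k P (l c) = algebraMap k P (ε c)
  rColin : RColin Δ (lastCoaction P D.right) l
  sext_right_mem : ∀ p, sext l (D.right p) ∈ D.coinvTensor
  psi_chi : ∀ w, D.psi l (D.chi l w) = w
  chi_psi : ∀ v, D.chi l (D.psi l v) = v
  psi_left : ∀ p, D.psi l (D.left p) = p ⊗ₜ e

variable {D}

/-- The first leg of u is in B, so it crosses the balanced tensor sign. This is what makes can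
injective. -/
theorem mk_smul_of_mem {u : P ⊗[k] P} (hu : u ∈ D.coinvTensor) (x : P) :
    (Submodule.Quotient.mk (x • u) : D.BalTensor) =
      Submodule.Quotient.mk (x ⊗ₜ LinearMap.mul' k P u) := by
  obtain ⟨u, rfl⟩ := hu
  induction u with
  | zero => simp
  | tmul b y =>
    rw [Submodule.Quotient.eq]
    exact Submodule.subset_span ⟨x, y, b, b.2, by simp [TensorProduct.smul_tmul']⟩
  | add a b ha hb =>
    rw [map_add, smul_add, Submodule.Quotient.mk_add, ha, hb, map_add, TensorProduct.tmul_add,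
      Submodule.Quotient.mk_add]

theorem coinv_rTensor_injective (M : Type*) [AddCommGroup M] [Module k M] :
    Function.Injective (D.coinv.val.toLinearMap.rTensor M) :=
  Module.Flat.rTensor_preserves_injective_linearMap _ Subtype.val_injective

theorem coinv_rTensor_smul (b : D.coinv) (u : D.coinv ⊗[k] P) :
    D.coinv.val.toLinearMap.rTensor P (b • u) =
      (b : P) • D.coinv.val.toLinearMap.rTensor P u :=
  rTensor_algHom_smul D.coinv.val b u

/-- Over a field B ⊗ P ⊗ C embeds in P ⊗ P ⊗ C, so colinearity of the splitting can be checked in P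
⊗ P. -/
theorem splitting_colinear_iff (s : P →ₗ[k] D.coinv ⊗[k] P) :
    D.right.lTensor D.coinv ∘ₗ s =
      (TensorProduct.assoc k D.coinv P C).toLinearMap ∘ₗ s.rTensor C ∘ₗ D.right ↔
    RColin D.right (lastCoaction P D.right) (D.coinv.val.toLinearMap.rTensor P ∘ₗ s) := by
  have h1 : ∀ u : D.coinv ⊗[k] P, D.coinv.val.toLinearMap.rTensor (P ⊗[k] C)
      (D.right.lTensor D.coinv u) =
      D.right.lTensor P (D.coinv.val.toLinearMap.rTensor P u) := by
    intro u
    induction u with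
    | zero => simp
    | tmul b x => simp
    | add a b ha hb => simp only [map_add, ha, hb]
  have h2 : ∀ u : (D.coinv ⊗[k] P) ⊗[k] C, D.coinv.val.toLinearMap.rTensor (P ⊗[k] C)
      (TensorProduct.assoc k D.coinv P C u) =
      TensorProduct.assoc k P P C ((D.coinv.val.toLinearMap.rTensor P).rTensor C u) := by
    intro u
    induction u with
    | zero => simp
    | tmul v c =>
      induction v with
      | zero => simp
      | tmul b x => simp
      | add a b ha hb => simp only [TensorProduct.add_tmul, map_add, ha, hb]
    | add a b ha hb => simp only [map_add, ha, hb]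
  rw [RColin, LinearMap.ext_iff, LinearMap.ext_iff]
  refine forall_congr' fun p => ?_
  rw [← (coinv_rTensor_injective (D := D) (P ⊗[k] C)).eq_iff]
  simp only [LinearMap.comp_apply, LinearEquiv.coe_coe, lastCoaction, h1, h2,
    LinearEquiv.symm_apply_eq, LinearMap.rTensor_comp]

namespace PrincipalData

variable {l : C →ₗ[k] P ⊗[k] P} (hl : D.PrincipalData l)
include hl

theorem canLift_apply (c : C) : D.canLift (l c) = 1 ⊗ₜ c := canLift_of_rColin hl.mul hl.rColin c

theorem canLift_sext (w : P ⊗[k] C) : D.canLift (sext l w) = w := by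
  induction w with
  | zero => simp
  | tmul p c => simp [canLift_smul, hl.canLift_apply, TensorProduct.smul_tmul']
  | add a b ha hb => simp only [map_add, ha, hb]

/-- Because y₀ l(y₁) lies in B ⊗ P and has product y, the element x y₀ l(y₁) becomes x ⊗ y over B.
Hence l gives a left inverse of can. -/
theorem mk_sext_canLift (t : P ⊗[k] P) :
    (Submodule.Quotient.mk (sext l (D.canLift t)) : D.BalTensor) = Submodule.Quotient.mk t := by
  induction t with
  | zero => simp
  | tmul x y =>
    rw [canLift_tmul, sext_smul, mk_smul_of_mem (hl.sext_right_mem y), mul'_sext hl.mul,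
      right_counit_apply]
  | add a b ha hb => simp only [map_add, Submodule.Quotient.mk_add, ha, hb]

theorem can_bijective : Function.Bijective D.can := by
  constructor
  · rw [injective_iff_map_eq_zero]
    intro t ht
    obtain ⟨t, rfl⟩ := Submodule.Quotient.mk_surjective _ t
    have ht' : D.canLift t = 0 := ht
    rw [← hl.mk_sext_canLift, ht', map_zero, Submodule.Quotient.mk_zero]
  · intro w
    exact ⟨Submodule.Quotient.mk (sext l w), hl.canLift_sext w⟩

theorem entwining_eq (h : Function.Bijective D.can) : D.entwining h = D.psi l := by
  refine TensorProduct.ext' fun c p => ?_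
  rw [← canMul_one_tmul, ← hl.canLift_apply, canMul_canLift]
  rfl

theorem equivariantlyProjective : D.EquivariantlyProjective := by
  have hinj := coinv_rTensor_injective (D := D) P
  -- The splitting is p ↦ p₀ l(p₁); the linear retraction `g` only moves its values from P ⊗ P back
  -- to B ⊗ P.
  obtain ⟨g, hg⟩ := LinearMap.exists_leftInverse_of_injective _ (LinearMap.ker_eq_bot.2 hinj)
  have hs : D.coinv.val.toLinearMap.rTensor P ∘ₗ (g ∘ₗ sext l ∘ₗ D.right) =
      sext l ∘ₗ D.right := by
    refine LinearMap.ext fun p => ?_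
    obtain ⟨u, hu⟩ := hl.sext_right_mem p
    simp only [LinearMap.comp_apply, ← hu]
    rw [show g (D.coinv.val.toLinearMap.rTensor P u) = u from LinearMap.congr_fun hg u]
  refine ⟨g ∘ₗ sext l ∘ₗ D.right, fun p => ?_, fun b p => hinj ?_, ?_⟩
  · rw [← LinearMap.comp_apply (f := D.coinv.val.toLinearMap.rTensor P), hs,
      LinearMap.comp_apply, mul'_sext hl.mul, right_counit_apply]
  · rw [coinv_rTensor_smul, ← LinearMap.comp_apply, ← LinearMap.comp_apply, hs,
      LinearMap.comp_apply, LinearMap.comp_apply, b.2 p, sext_smul]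
  · rw [splitting_colinear_iff, hs]
    exact hl.rColin.sext.comp D.right_rColin

theorem isPrincipal : D.IsPrincipal := by
  refine ⟨hl.can_bijective, ?_, hl.equivariantlyProjective, ?_⟩
  · rw [hl.entwining_eq]
    exact ⟨Function.LeftInverse.injective hl.chi_psi, Function.RightInverse.surjective hl.psi_chi⟩
  · rw [hl.entwining_eq]
    exact hl.psi_left

end PrincipalData

/-- Here `psi` is the canonical entwining and `chi` is a right inverse of it; injectivity of the
entwining makes the inverse two-sided. -/
theorem StrongConnection.principalData (hD : D.IsPrincipal) {l : C →ₗ[k] P ⊗[k] P}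
    (hl : D.StrongConnection l) : D.PrincipalData l := by
  obtain ⟨h, hψ, -, hleft⟩ := hD
  have hpsi : D.entwining h = D.psi l := by
    refine TensorProduct.ext' fun c p => ?_
    rw [← canMul_one_tmul, ← hl.canLift, canMul_canLift]
    rfl
  have hchi : ∀ w, D.entwining h (D.chi l w) = w := by
    intro w
    rw [chi, LinearMap.comp_apply, entwining_canLiftL h hleft]
    induction w with
    | zero => simp
    | tmul p c => simp [canLift_smul, hl.canLift, TensorProduct.smul_tmul']
    | add a b ha hb => simp only [map_add, ha, hb]
  exact ⟨hl.mul, hl.rColin, CoaugCoactions.sext_right_mem h hleft hl.lColin,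
    fun w => by rw [← hpsi, hchi], fun v => hψ.1 (by rw [hchi, hpsi]),
    fun p => by rw [← hpsi, hleft]⟩

theorem IsPrincipal.exists_strongConnection (hD : D.IsPrincipal) :
    ∃ l, D.StrongConnection l := by
  obtain ⟨h, hψ, ⟨s, hs1, hs2, hs3⟩, hleft⟩ := hD
  set s' : P →ₗ[k] P ⊗[k] P := D.coinv.val.toLinearMap.rTensor P ∘ₗ s with hs'
  have hs'r : RColin D.right (lastCoaction P D.right) s' := (splitting_colinear_iff s).1 hs3
  set σ : P ⊗[k] P →ₗ[k] P ⊗[k] P := sext s' with hσ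
  have hker : D.balancing ≤ LinearMap.ker σ := by
    refine Submodule.span_le.2 ?_
    rintro _ ⟨p, p', b, hb, rfl⟩
    have : s' (b * p') = b • s' p' := by
      have := hs2 ⟨b, hb⟩ p'
      simp only [hs', LinearMap.comp_apply]
      rw [← coinv_rTensor_smul ⟨b, hb⟩, ← this]
    simp [hσ, this, mul_smul]
  set Λ : P ⊗[k] C →ₗ[k] P ⊗[k] P :=
    D.balancing.liftQ σ hker ∘ₗ (LinearEquiv.ofBijective D.can h).symm.toLinearMap with hΛ
  have hΛσ : Λ ∘ₗ D.canLift = σ := by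
    refine LinearMap.ext fun t => ?_
    simp only [hΛ, LinearMap.comp_apply, LinearEquiv.coe_coe, can_symm_canLift]
    rfl
  have hmul : ∀ t, LinearMap.mul' k P (σ t) = LinearMap.mul' k P t := by
    intro t
    induction t with
    | zero => simp
    | tmul x y => rw [hσ, sext_tmul, mul'_smul, hs', LinearMap.comp_apply, hs1]; rfl
    | add a b ha hb => simp only [map_add, ha, hb]
  have hcanL : (D.entwining h) ∘ₗ D.canLiftL = D.canLift :=
    LinearMap.ext (entwining_canLiftL h hleft)
  have hΛr : RColin (lastCoaction P Δ) (lastCoaction P D.right) Λ :=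
    RColin.of_comp_surjective (by rw [hΛσ]; exact hs'r.sext) D.canLift_rColin
      (D.canLift_surjective h)
  -- After composing with ψ, the map descends from σ along the left canonical map, so it inherits
  -- the left colinearity of σ.
  have hΛl : LColin (firstCoaction P Δ) (firstCoaction P D.left) (Λ ∘ₗ D.entwining h) := by
    refine LColin.of_comp_surjective ?_ D.canLiftL_lColin ?_
    · rw [LinearMap.comp_assoc, hcanL, hΛσ]
      exact sext_lColin h hψ.1 hleft fun p => ⟨s p, rfl⟩
    · intro v
      obtain ⟨t, ht⟩ := D.canLift_surjective h (D.entwining h v)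
      exact ⟨t, hψ.1 (by rw [entwining_canLiftL h hleft, ht])⟩
  -- Since ψ(c ⊗ 1) = 1 ⊗ c, one map has two descriptions: the first shows right colinearity, the
  -- second left colinearity.
  have hl : Λ ∘ₗ TensorProduct.mk k P C 1 =
      (Λ ∘ₗ D.entwining h) ∘ₗ (TensorProduct.mk k C P).flip 1 := by
    refine LinearMap.ext fun c => ?_
    simp [entwining_one]
  refine ⟨Λ ∘ₗ TensorProduct.mk k P C 1, fun c => ?_, hΛr.comp ?_, ?_⟩
  · obtain ⟨t, ht⟩ := D.canLift_surjective h (1 ⊗ₜ c)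
    rw [LinearMap.comp_apply, TensorProduct.mk_apply, ← ht,
      show Λ (D.canLift t) = σ t from LinearMap.congr_fun hΛσ t, hmul, ← D.rid_canLift, ht]
    simp [Algebra.algebraMap_eq_smul_one]
  · refine LinearMap.ext fun c => ?_
    simp only [LinearMap.comp_apply, TensorProduct.mk_apply, lastCoaction_tmul]
    induction Δ c with
    | zero => simp
    | tmul c d => simp
    | add a b ha hb => simp only [TensorProduct.tmul_add, map_add, ha, hb]
  · rw [hl]
    refine hΛl.comp (LinearMap.ext fun c => ?_)
    simp only [LinearMap.comp_apply, LinearMap.flip_apply, TensorProduct.mk_apply,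
      firstCoaction_tmul]
    induction Δ c with
    | zero => simp
    | tmul c d => simp
    | add a b ha hb => simp only [TensorProduct.add_tmul, map_add, ha, hb]

end Criterion

/-! ### Transfer of principality along morphisms. -/

section Transfer

variable {D} {Q : Type*} [Ring Q] [Algebra k Q] {E : CoaugCoactions k e Q} {f : P →ₐ[k] Q}

theorem IsMorphism.right_apply (hf : D.IsMorphism E f) (p : P) :
    E.right (f p) = f.toLinearMap.rTensor C (D.right p) := LinearMap.congr_fun hf.1 p

theorem IsMorphism.left_apply (hf : D.IsMorphism E f) (p : P) :
    E.left (f p) = f.toLinearMap.lTensor C (D.left p) := LinearMap.congr_fun hf.2 p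

theorem mul'_map (t : P ⊗[k] P) :
    LinearMap.mul' k Q (TensorProduct.map f.toLinearMap f.toLinearMap t) =
      f (LinearMap.mul' k P t) := by
  induction t with
  | zero => simp
  | tmul x y => simp
  | add a b ha hb => simp only [map_add, ha, hb]

omit [Coalgebra k C] in
theorem sext_map (l : C →ₗ[k] P ⊗[k] P) (w : P ⊗[k] C) :
    sext (TensorProduct.map f.toLinearMap f.toLinearMap ∘ₗ l) (f.toLinearMap.rTensor C w) =
      TensorProduct.map f.toLinearMap f.toLinearMap (sext l w) := by
  induction w with
  | zero => simp
  | tmul x y => simp [map_algHom_smul]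
  | add a b ha hb => simp only [map_add, ha, hb]

omit [Coalgebra k C] in
theorem rext_map (l : C →ₗ[k] P ⊗[k] P) (w : C ⊗[k] P) :
    rext (TensorProduct.map f.toLinearMap f.toLinearMap ∘ₗ l) (f.toLinearMap.lTensor C w) =
      TensorProduct.map f.toLinearMap f.toLinearMap (rext l w) := by
  induction w with
  | zero => simp
  | tmul x y => simp [map_algHom_rmul]
  | add a b ha hb => simp only [map_add, ha, hb]

theorem IsMorphism.canLift_map (hf : D.IsMorphism E f) (t : P ⊗[k] P) :
    E.canLift (TensorProduct.map f.toLinearMap f.toLinearMap t) =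
      f.toLinearMap.rTensor C (D.canLift t) := by
  induction t with
  | zero => simp
  | tmul x y => simp [rTensor_algHom_smul, hf.right_apply]
  | add a b ha hb => simp only [map_add, ha, hb]

theorem IsMorphism.canLiftL_map (hf : D.IsMorphism E f) (t : P ⊗[k] P) :
    E.canLiftL (TensorProduct.map f.toLinearMap f.toLinearMap t) =
      f.toLinearMap.lTensor C (D.canLiftL t) := by
  induction t with
  | zero => simp
  | tmul x y => simp [lTensor_algHom_rmul, hf.left_apply]
  | add a b ha hb => simp only [map_add, ha, hb]

theorem IsMorphism.psi_map (hf : D.IsMorphism E f) (l : C →ₗ[k] P ⊗[k] P) (v : C ⊗[k] P) :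
    E.psi (TensorProduct.map f.toLinearMap f.toLinearMap ∘ₗ l) (f.toLinearMap.lTensor C v) =
      f.toLinearMap.rTensor C (D.psi l v) := by
  simp only [psi, LinearMap.comp_apply, rext_map, hf.canLift_map]

theorem IsMorphism.chi_map (hf : D.IsMorphism E f) (l : C →ₗ[k] P ⊗[k] P) (w : P ⊗[k] C) :
    E.chi (TensorProduct.map f.toLinearMap f.toLinearMap ∘ₗ l) (f.toLinearMap.rTensor C w) =
      f.toLinearMap.lTensor C (D.chi l w) := by
  simp only [chi, LinearMap.comp_apply, sext_map, hf.canLiftL_map]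

theorem IsMorphism.map_rColin (hf : D.IsMorphism E f) :
    RColin (lastCoaction P D.right) (lastCoaction Q E.right)
      (TensorProduct.map f.toLinearMap f.toLinearMap) := RColin.map _ hf.1

theorem IsMorphism.map_mem_coinv (hf : D.IsMorphism E f) (hs : Function.Surjective f) {b : P}
    (hb : b ∈ D.coinv) : f b ∈ E.coinv := by
  intro q
  obtain ⟨p, rfl⟩ := hs q
  rw [← map_mul, hf.right_apply, hb p, rTensor_algHom_smul, hf.right_apply]

theorem IsMorphism.map_mem_coinvTensor (hf : D.IsMorphism E f) (hs : Function.Surjective f)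
    {t : P ⊗[k] P} (ht : t ∈ D.coinvTensor) :
    TensorProduct.map f.toLinearMap f.toLinearMap t ∈ E.coinvTensor := by
  obtain ⟨u, rfl⟩ := ht
  induction u with
  | zero => simp
  | tmul b x => exact ⟨⟨f b, hf.map_mem_coinv hs b.2⟩ ⊗ₜ f x, by simp⟩
  | add a b ha hb => rw [map_add, map_add]; exact add_mem ha hb

/-- Each identity is natural in the algebra, and surjectivity makes every argument the image of one
from P. -/
theorem PrincipalData.map_surjective {l : C →ₗ[k] P ⊗[k] P} (hl : D.PrincipalData l)
    (hf : D.IsMorphism E f) (hs : Function.Surjective f) :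
    E.PrincipalData (TensorProduct.map f.toLinearMap f.toLinearMap ∘ₗ l) where
  mul c := by rw [LinearMap.comp_apply, mul'_map, hl.mul, AlgHom.commutes]
  rColin := hf.map_rColin.comp hl.rColin
  sext_right_mem q := by
    obtain ⟨p, rfl⟩ := hs q
    rw [hf.right_apply, sext_map]
    exact hf.map_mem_coinvTensor hs (hl.sext_right_mem p)
  psi_chi w := by
    obtain ⟨w, rfl⟩ := LinearMap.rTensor_surjective C (g := f.toLinearMap) hs w
    rw [hf.chi_map, hf.psi_map, hl.psi_chi]
  chi_psi v := by
    obtain ⟨v, rfl⟩ := LinearMap.lTensor_surjective C (g := f.toLinearMap) hs v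
    rw [hf.psi_map, hf.chi_map, hl.chi_psi]
  psi_left q := by
    obtain ⟨p, rfl⟩ := hs q
    rw [hf.left_apply, hf.psi_map, hl.psi_left]
    simp

theorem IsPrincipal.of_surjective (hD : D.IsPrincipal) (hf : D.IsMorphism E f)
    (hs : Function.Surjective f) : E.IsPrincipal := by
  obtain ⟨l, hl⟩ := hD.exists_strongConnection
  exact ((hl.principalData hD).map_surjective hf hs).isPrincipal

/-- Bijectivity of can for the subobject is not assumed; that of the ambient object makes f(b)
coinvariant, and injectivity brings this back. -/
theorem IsMorphism.mem_coinv_of_injective (hf : D.IsMorphism E f) (hi : Function.Injective f)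
    (hE : Function.Bijective E.can) {b : P} (hb : D.right b = b ⊗ₜ e) : b ∈ D.coinv := by
  intro p
  apply Module.Flat.rTensor_preserves_injective_linearMap (M := C) f.toLinearMap hi
  have hfb : f b ∈ E.coinv := by
    rw [mem_coinv_iff hE, hf.right_apply, hb]; simp
  rw [← hf.right_apply, rTensor_algHom_smul, ← hf.right_apply, map_mul, hfb]

theorem PrincipalData.of_injective {l : C →ₗ[k] P ⊗[k] P} (hE : Function.Bijective E.can)
    (hl : E.PrincipalData (TensorProduct.map f.toLinearMap f.toLinearMap ∘ₗ l))
    (hf : D.IsMorphism E f) (hi : Function.Injective f) : D.PrincipalData l := by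
  have hr : Function.Injective (f.toLinearMap.rTensor C) :=
    Module.Flat.rTensor_preserves_injective_linearMap _ hi
  have hlT : Function.Injective (f.toLinearMap.lTensor C) :=
    Module.Flat.lTensor_preserves_injective_linearMap _ hi
  have hmap : Function.Injective (TensorProduct.map f.toLinearMap f.toLinearMap) := by
    rw [← LinearMap.rTensor_comp_lTensor]
    exact (Module.Flat.rTensor_preserves_injective_linearMap _ hi).comp
      (Module.Flat.lTensor_preserves_injective_linearMap _ hi)
  refine ⟨fun c => hi ?_, hl.rColin.of_comp_injective hf.map_rColin hmap, fun p => ?_,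
    fun w => hr ?_, fun v => hlT ?_, fun p => hr ?_⟩
  · rw [← mul'_map, AlgHom.commutes]; exact hl.mul c
  · apply mem_coinvTensor fun b => hf.mem_coinv_of_injective hi hE
    have hinj : Function.Injective (TensorProduct.map (f.toLinearMap.rTensor C) f.toLinearMap) := by
      rw [← LinearMap.rTensor_comp_lTensor]
      exact (Module.Flat.rTensor_preserves_injective_linearMap _ hr).comp
        (Module.Flat.lTensor_preserves_injective_linearMap _ hi)
    apply hinj
    have h1 : ∀ t, TensorProduct.map (f.toLinearMap.rTensor C) f.toLinearMap
        (D.right.rTensor P t) =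
        E.right.rTensor Q (TensorProduct.map f.toLinearMap f.toLinearMap t) := by
      intro t
      induction t with
      | zero => simp
      | tmul x y => simp [hf.right_apply]
      | add a b ha hb => simp only [map_add, ha, hb]
    have h2 : ∀ t, TensorProduct.map (f.toLinearMap.rTensor C) f.toLinearMap
        ((trivCoaction k P e).rTensor P t) =
        (trivCoaction k Q e).rTensor Q (TensorProduct.map f.toLinearMap f.toLinearMap t) := by
      intro t
      induction t with
      | zero => simp
      | tmul x y => simp
      | add a b ha hb => simp only [map_add, ha, hb]
    rw [h1, h2, ← sext_map, ← hf.right_apply]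
    exact rTensor_right_of_mem (hl.sext_right_mem (f p))
  · rw [← hf.psi_map, ← hf.chi_map, hl.psi_chi]
  · rw [← hf.chi_map, ← hf.psi_map, hl.chi_psi]
  · rw [← hf.psi_map, ← hf.left_apply, hl.psi_left]; simp

end Transfer

/-! ### Lifting coinvariants and colinear sections. -/

section Sections

variable {D}

theorem mul_left_coinv_rColin {τ : P →ₗ[k] P} (hτ : ∀ x, τ x ∈ D.coinv) :
    RColin (lastCoaction P D.right) D.right (LinearMap.mul' k P ∘ₗ τ.rTensor P) := by
  refine TensorProduct.ext' fun x y => ?_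
  simp only [LinearMap.comp_apply, LinearMap.rTensor_tmul, LinearMap.mul'_apply,
    lastCoaction_tmul, hτ x y]
  induction D.right y with
  | zero => simp
  | tmul z c => simp [TensorProduct.smul_tmul']
  | add a b ha hb => simp only [TensorProduct.tmul_add, map_add, smul_add, ha, hb]

theorem IsPrincipal.mul_right_coinv_lColin (hD : D.IsPrincipal) {τ : P →ₗ[k] P}
    (hτ : ∀ x, τ x ∈ D.coinv) :
    LColin (firstCoaction P D.left) D.left (LinearMap.mul' k P ∘ₗ τ.lTensor P) := by
  obtain ⟨h, hψ, -, hleft⟩ := hD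
  refine TensorProduct.ext' fun x y => ?_
  simp only [LinearMap.comp_apply, LinearMap.lTensor_tmul, LinearMap.mul'_apply,
    firstCoaction_tmul, left_mul_coinv h hleft hψ.1 x (hτ y)]
  induction D.left x with
  | zero => simp
  | tmul c z => simp
  | add a b ha hb => simp only [TensorProduct.add_tmul, map_add, ha, hb]

variable (D) in
theorem exists_coinv_retraction :
    ∃ τ : P →ₗ[k] D.coinv, ∀ b : D.coinv, τ b = b := by
  obtain ⟨g, hg⟩ := LinearMap.exists_leftInverse_of_injective D.coinv.val.toLinearMap
    (LinearMap.ker_eq_bot.2 Subtype.val_injective)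
  exact ⟨g, fun b => LinearMap.congr_fun hg b⟩

/-- Agreement on B modulo f is enough. This covers retractions onto B (with f the identity) as well
as lifts of coinvariants of Q. -/
theorem map_mul'_rTensor_of_mem {Q : Type*} [Ring Q] [Algebra k Q] (f : P →ₐ[k] Q)
    {τ : P →ₗ[k] P} (hτ : ∀ b ∈ D.coinv, f (τ b) = f b) {t : P ⊗[k] P}
    (ht : t ∈ D.coinvTensor) :
    f (LinearMap.mul' k P (τ.rTensor P t)) = f (LinearMap.mul' k P t) := by
  obtain ⟨u, rfl⟩ := ht
  induction u with
  | zero => simp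
  | tmul b x => simp [hτ b b.2]
  | add a b ha hb => simp only [map_add, ha, hb]

theorem map_mul'_lTensor_of_mem {Q : Type*} [Ring Q] [Algebra k Q] (f : P →ₐ[k] Q)
    {τ : P →ₗ[k] P} (hτ : ∀ b ∈ D.coinv, f (τ b) = f b) {t : P ⊗[k] P}
    (ht : t ∈ D.tensorCoinv) :
    f (LinearMap.mul' k P (τ.lTensor P t)) = f (LinearMap.mul' k P t) := by
  obtain ⟨u, rfl⟩ := ht
  induction u with
  | zero => simp
  | tmul x b => simp [hτ b b.2]
  | add a b ha hb => simp only [map_add, ha, hb]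

theorem StrongConnection.sext_right_mem (hD : D.IsPrincipal) {l : C →ₗ[k] P ⊗[k] P}
    (hl : D.StrongConnection l) (p : P) : sext l (D.right p) ∈ D.coinvTensor :=
  (hl.principalData hD).sext_right_mem p

theorem StrongConnection.rext_left_mem (hD : D.IsPrincipal) {l : C →ₗ[k] P ⊗[k] P}
    (hl : D.StrongConnection l) (p : P) : rext l (D.left p) ∈ D.tensorCoinv := by
  obtain ⟨h, -, -, hleft⟩ := hD
  exact CoaugCoactions.rext_left_mem h hleft hl.rColin p

theorem StrongConnection.mul'_sext_right {l : C →ₗ[k] P ⊗[k] P} (hl : D.StrongConnection l)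
    (p : P) : LinearMap.mul' k P (sext l (D.right p)) = p := by
  rw [mul'_sext hl.mul, right_counit_apply]

theorem StrongConnection.mul'_rext_left {l : C →ₗ[k] P ⊗[k] P} (hl : D.StrongConnection l)
    (p : P) : LinearMap.mul' k P (rext l (D.left p)) = p := by
  rw [mul'_rext hl.mul, left_counit_apply]

theorem sext_right_one (l : C →ₗ[k] P ⊗[k] P) : sext l (D.right 1) = l e := by
  rw [D.right_one, sext_tmul, one_smul]

theorem rext_left_one (l : C →ₗ[k] P ⊗[k] P) : rext l (D.left 1) = l e := by
  rw [D.left_one, rext_tmul, rmul_one]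

/-- A unital right colinear map `C → P`. -/
theorem IsPrincipal.exists_unital_rColin (hD : D.IsPrincipal) :
    ∃ ρ : C →ₗ[k] P, RColin Δ D.right ρ ∧ ρ e = 1 := by
  obtain ⟨l, hl⟩ := hD.exists_strongConnection
  obtain ⟨τ, hτ⟩ := D.exists_coinv_retraction
  refine ⟨(LinearMap.mul' k P ∘ₗ (D.coinv.val.toLinearMap ∘ₗ τ).rTensor P) ∘ₗ l,
    (mul_left_coinv_rColin fun x => (τ x).2).comp hl.rColin, ?_⟩
  -- Taking p = 1 in p₀ l(p₁) ∈ B ⊗ P shows l(e) ∈ B ⊗ P with product 1, and τ fixes B.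
  have h := map_mul'_rTensor_of_mem (AlgHom.id k P) (τ := D.coinv.val.toLinearMap ∘ₗ τ)
    (fun b hb => by simp [hτ ⟨b, hb⟩]) (hl.sext_right_mem hD 1)
  rw [hl.mul'_sext_right, sext_right_one] at h
  exact h

/-- A unital left colinear map `C → P` of the form `c ↦ l(c)⁽¹⁾ τ(l(c)⁽²⁾)`. -/
theorem StrongConnection.left_unital (hD : D.IsPrincipal) {l : C →ₗ[k] P ⊗[k] P}
    (hl : D.StrongConnection l) {τ : P →ₗ[k] D.coinv} (hτ : ∀ b : D.coinv, τ b = b) :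
    LinearMap.mul' k P ((D.coinv.val.toLinearMap ∘ₗ τ).lTensor P (l e)) = 1 := by
  have h := map_mul'_lTensor_of_mem (AlgHom.id k P) (τ := D.coinv.val.toLinearMap ∘ₗ τ)
    (fun b hb => by simp [hτ ⟨b, hb⟩]) (hl.rext_left_mem hD 1)
  rw [hl.mul'_rext_left, rext_left_one] at h
  exact h

theorem IsPrincipal.exists_unital_lColin (hD : D.IsPrincipal) :
    ∃ ρ : C →ₗ[k] P, LColin Δ D.left ρ ∧ ρ e = 1 := by
  obtain ⟨l, hl⟩ := hD.exists_strongConnection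
  obtain ⟨τ, hτ⟩ := D.exists_coinv_retraction
  exact ⟨(LinearMap.mul' k P ∘ₗ (D.coinv.val.toLinearMap ∘ₗ τ).lTensor P) ∘ₗ l,
    (hD.mul_right_coinv_lColin fun x => (τ x).2).comp hl.lColin, hl.left_unital hD hτ⟩

variable {Q : Type*} [Ring Q] [Algebra k Q] {E : CoaugCoactions k e Q} {f : P →ₐ[k] Q}

/-- Coinvariants lift along a surjective morphism out of a principal object. -/
theorem IsPrincipal.exists_coinv_lift (hD : D.IsPrincipal) (hf : D.IsMorphism E f)
    (hs : Function.Surjective f) {b : Q} (hb : b ∈ E.coinv) : ∃ a ∈ D.coinv, f a = b := by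
  obtain ⟨l, hl⟩ := hD.exists_strongConnection
  obtain ⟨τ, hτ⟩ := D.exists_coinv_retraction
  obtain ⟨p, rfl⟩ := hs b
  set τ' := D.coinv.val.toLinearMap ∘ₗ τ with hτ'
  refine ⟨LinearMap.mul' k P (τ'.lTensor P (sext l (D.right p))), ?_, ?_⟩
  · obtain ⟨u, hu⟩ := hl.sext_right_mem hD p
    rw [← hu]
    clear hu
    induction u with
    | zero => simp
    | tmul b x => simpa [hτ'] using mul_mem b.2 (τ x).2
    | add a b ha hb => simp only [map_add]; exact add_mem ha hb
  · set ρ : C →ₗ[k] P := LinearMap.mul' k P ∘ₗ τ'.lTensor P ∘ₗ l with hρ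
    have h0 : ∀ (p : P) (t : P ⊗[k] P), τ'.lTensor P (p • t) = p • τ'.lTensor P t :=
      fun p t => lTensor_smul_left _ _ _
    -- The image depends only on (f ⊗ id)Δ(p) = Δ(f(p)), which is f(p) ⊗ e because f(p) is
    -- coinvariant.
    have h1 : ∀ w : P ⊗[k] C, f (LinearMap.mul' k P (τ'.lTensor P (sext l w))) =
        LinearMap.mul' k Q ((f.toLinearMap ∘ₗ ρ).lTensor Q (f.toLinearMap.rTensor C w)) := by
      intro w
      induction w with
      | zero => simp
      | tmul p c => simp [h0, mul'_smul, hρ]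
      | add a b ha hb => simp only [map_add, ha, hb]
    have h2 : ρ e = 1 := hl.left_unital hD hτ
    rw [h1, ← hf.right_apply, E.right_of_mem_coinv hb]
    simp [h2]

/-- A linear section of the surjection on coinvariants, extended to all of Q by a linear retraction.
-/
theorem IsPrincipal.exists_coinv_section (hD : D.IsPrincipal) (hf : D.IsMorphism E f)
    (hs : Function.Surjective f) :
    ∃ σ : Q →ₗ[k] P, (∀ q, σ q ∈ D.coinv) ∧ ∀ b ∈ E.coinv, f (σ b) = b := by
  let g : D.coinv →ₗ[k] E.coinv :=
    { toFun := fun b => ⟨f b, hf.map_mem_coinv hs b.2⟩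
      map_add' := fun a b => Subtype.ext (by simp)
      map_smul' := fun r b => Subtype.ext (by simp) }
  have hg : Function.Surjective g := by
    rintro ⟨b, hb⟩
    obtain ⟨a, ha, rfl⟩ := hD.exists_coinv_lift hf hs hb
    exact ⟨⟨a, ha⟩, rfl⟩
  obtain ⟨σ, hσ⟩ := LinearMap.exists_rightInverse_of_surjective g (LinearMap.range_eq_top.2 hg)
  obtain ⟨τ, hτ⟩ := E.exists_coinv_retraction
  refine ⟨D.coinv.val.toLinearMap ∘ₗ σ ∘ₗ τ, fun q => (σ (τ q)).2, fun b hb => ?_⟩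
  have h1 : τ b = ⟨b, hb⟩ := hτ ⟨b, hb⟩
  have h2 : g (σ ⟨b, hb⟩) = ⟨b, hb⟩ := LinearMap.congr_fun hσ _
  simp only [LinearMap.comp_apply, h1]
  exact congrArg Subtype.val h2

/-- A surjective morphism out of a principal object has a right colinear section. -/
theorem IsPrincipal.exists_rColin_section (hD : D.IsPrincipal) (hf : D.IsMorphism E f)
    (hs : Function.Surjective f) :
    ∃ α : Q →ₗ[k] P, (∀ q, f (α q) = q) ∧ RColin E.right D.right α := by
  obtain ⟨l, hl⟩ := hD.exists_strongConnection
  obtain ⟨σ, hσ, hσ'⟩ := hD.exists_coinv_section hf hs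
  -- Only the first leg of l is pushed to Q. For q = f(p) this gives (f ⊗ id)(p₀ l(p₁)), whose first
  -- leg is coinvariant and can be lifted by σ.
  let α : Q →ₗ[k] P := LinearMap.mul' k P ∘ₗ σ.rTensor P ∘ₗ
    sext (f.toLinearMap.rTensor P ∘ₗ l) ∘ₗ E.right
  have h1 : ∀ w : P ⊗[k] C, sext (f.toLinearMap.rTensor P ∘ₗ l) (f.toLinearMap.rTensor C w) =
      f.toLinearMap.rTensor P (sext l w) := by
    intro w
    induction w with
    | zero => simp
    | tmul p c => simp [rTensor_algHom_smul]
    | add a b ha hb => simp only [map_add, ha, hb]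
  have hα : α ∘ₗ f.toLinearMap = (LinearMap.mul' k P ∘ₗ (σ ∘ₗ f.toLinearMap).rTensor P) ∘ₗ
      sext l ∘ₗ D.right := by
    refine LinearMap.ext fun p => ?_
    simp only [α, LinearMap.comp_apply, AlgHom.toLinearMap_apply, hf.right_apply, h1,
      LinearMap.rTensor_comp]
  refine ⟨α, fun q => ?_, RColin.of_comp_surjective ?_ hf.1 hs⟩
  · obtain ⟨p, rfl⟩ := hs q
    rw [show α (f p) = _ from LinearMap.congr_fun hα p, LinearMap.comp_apply, LinearMap.comp_apply,
      map_mul'_rTensor_of_mem f (fun b hb => hσ' _ (hf.map_mem_coinv hs hb))]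
    · exact congrArg f (hl.mul'_sext_right p)
    · exact hl.sext_right_mem hD p
  · rw [hα]
    exact (mul_left_coinv_rColin fun x => hσ _).comp (hl.rColin.sext.comp D.right_rColin)

/-- A surjective morphism out of a principal object has a left colinear section. -/
theorem IsPrincipal.exists_lColin_section (hD : D.IsPrincipal) (hf : D.IsMorphism E f)
    (hs : Function.Surjective f) :
    ∃ α : Q →ₗ[k] P, (∀ q, f (α q) = q) ∧ LColin E.left D.left α := by
  obtain ⟨l, hl⟩ := hD.exists_strongConnection
  obtain ⟨σ, hσ, hσ'⟩ := hD.exists_coinv_section hf hs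
  let α : Q →ₗ[k] P := LinearMap.mul' k P ∘ₗ σ.lTensor P ∘ₗ
    rext (f.toLinearMap.lTensor P ∘ₗ l) ∘ₗ E.left
  have h1 : ∀ w : C ⊗[k] P, rext (f.toLinearMap.lTensor P ∘ₗ l) (f.toLinearMap.lTensor C w) =
      f.toLinearMap.lTensor P (rext l w) := by
    intro w
    induction w with
    | zero => simp
    | tmul p c => simp [lTensor_algHom_rmul]
    | add a b ha hb => simp only [map_add, ha, hb]
  have hα : α ∘ₗ f.toLinearMap = (LinearMap.mul' k P ∘ₗ (σ ∘ₗ f.toLinearMap).lTensor P) ∘ₗ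
      rext l ∘ₗ D.left := by
    refine LinearMap.ext fun p => ?_
    simp only [α, LinearMap.comp_apply, AlgHom.toLinearMap_apply, hf.left_apply, h1,
      LinearMap.lTensor_comp]
  refine ⟨α, fun q => ?_, LColin.of_comp_surjective ?_ hf.2 hs⟩
  · obtain ⟨p, rfl⟩ := hs q
    rw [show α (f p) = _ from LinearMap.congr_fun hα p, LinearMap.comp_apply, LinearMap.comp_apply,
      map_mul'_lTensor_of_mem f (fun b hb => hσ' _ (hf.map_mem_coinv hs hb))]
    · exact congrArg f (hl.mul'_rext_left p)
    · exact hl.rext_left_mem hD p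
  · rw [hα]
    exact (hD.mul_right_coinv_lColin fun x => hσ _).comp (hl.lColin.rext.comp D.left_lColin)

theorem exists_unital_functional (k Q : Type*) [Field k] [Ring Q] [Algebra k Q] [Nontrivial Q] :
    ∃ φ : Q →ₗ[k] k, φ 1 = 1 := by
  obtain ⟨φ, hφ⟩ := LinearMap.exists_leftInverse_of_injective (Algebra.linearMap k Q)
    (LinearMap.ker_eq_bot.2 (algebraMap k Q).injective)
  exact ⟨φ, by simpa using LinearMap.congr_fun hφ 1⟩

/-- Coassociativity makes q ↦ φ(q₀) q₁ colinear; when φ(1) = 1 it sends 1 to e. -/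
theorem right_functional_rColin (E : CoaugCoactions k e Q) (φ : Q →ₗ[k] k) :
    RColin E.right Δ ((TensorProduct.lid k C).toLinearMap ∘ₗ φ.rTensor C ∘ₗ E.right) := by
  refine LinearMap.ext fun q => ?_
  have h1 : ∀ w : Q ⊗[k] C, Δ (TensorProduct.lid k C (φ.rTensor C w)) =
      TensorProduct.lid k (C ⊗[k] C) (φ.rTensor (C ⊗[k] C) ((Δ).lTensor Q w)) := by
    intro w
    induction w with
    | zero => simp
    | tmul p c => simp
    | add a b ha hb => simp only [map_add, ha, hb]
  have h2 : ∀ w : (Q ⊗[k] C) ⊗[k] C,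
      TensorProduct.lid k (C ⊗[k] C) (φ.rTensor (C ⊗[k] C) (TensorProduct.assoc k Q C C w)) =
      (TensorProduct.lid k C).toLinearMap.rTensor C ((φ.rTensor C).rTensor C w) := by
    intro w
    induction w with
    | zero => simp
    | tmul v c =>
      induction v with
      | zero => simp
      | tmul x y => simp [TensorProduct.smul_tmul']
      | add a b ha hb => simp only [TensorProduct.add_tmul, map_add, ha, hb]
    | add a b ha hb => simp only [map_add, ha, hb]
  have h3 : (Δ).lTensor Q (E.right q) = TensorProduct.assoc k Q C C (E.right.rTensor C (E.right q)) :=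
    (LinearMap.congr_fun E.right_coassoc q).symm
  simp only [LinearMap.comp_apply, LinearEquiv.coe_coe, h1, h3, h2, LinearMap.rTensor_comp]

theorem left_functional_lColin (E : CoaugCoactions k e Q) (φ : Q →ₗ[k] k) :
    LColin E.left Δ ((TensorProduct.rid k C).toLinearMap ∘ₗ φ.lTensor C ∘ₗ E.left) := by
  refine LinearMap.ext fun q => ?_
  have h1 : ∀ w : C ⊗[k] Q, Δ (TensorProduct.rid k C (φ.lTensor C w)) =
      TensorProduct.rid k (C ⊗[k] C) (φ.lTensor (C ⊗[k] C) ((Δ).rTensor Q w)) := by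
    intro w
    induction w with
    | zero => simp
    | tmul p c => simp
    | add a b ha hb => simp only [map_add, ha, hb]
  have h2 : ∀ w : (C ⊗[k] C) ⊗[k] Q,
      TensorProduct.rid k (C ⊗[k] C) (φ.lTensor (C ⊗[k] C) w) =
      (TensorProduct.rid k C).toLinearMap.lTensor C
        ((φ.lTensor C).lTensor C (TensorProduct.assoc k C C Q w)) := by
    intro w
    induction w with
    | zero => simp
    | tmul v c =>
      induction v with
      | zero => simp
      | tmul x y => simp
      | add a b ha hb => simp only [TensorProduct.add_tmul, map_add, ha, hb]
    | add a b ha hb => simp only [map_add, ha, hb]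
  have h3 : TensorProduct.assoc k C C Q ((Δ).rTensor Q (E.left q)) = E.left.lTensor C (E.left q) :=
    (LinearMap.congr_fun E.left_coassoc q).symm
  simp only [LinearMap.comp_apply, LinearEquiv.coe_coe, h1, h3, h2, LinearMap.lTensor_comp]

theorem IsPrincipal.exists_unital_rColin_section [Nontrivial Q] (hD : D.IsPrincipal)
    (hf : D.IsMorphism E f) (hs : Function.Surjective f) :
    ∃ α : Q →ₗ[k] P, (∀ q, f (α q) = q) ∧ α 1 = 1 ∧ RColin E.right D.right α := by
  obtain ⟨α₀, h₀, hc₀⟩ := hD.exists_rColin_section hf hs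
  obtain ⟨ρ, hρ, hρe⟩ := hD.exists_unital_rColin
  obtain ⟨φ, hφ⟩ := exists_unital_functional k Q
  set α₁ := ρ ∘ₗ ((TensorProduct.lid k C).toLinearMap ∘ₗ φ.rTensor C ∘ₗ E.right) with hα₁
  have hc₁ : RColin E.right D.right α₁ := hρ.comp (right_functional_rColin E φ)
  have h₁ : α₁ 1 = 1 := by simp [hα₁, E.right_one, hφ, hρe]
  have hfc : RColin D.right E.right f.toLinearMap := hf.1
  -- The added term α₁ - α₀ f α₁ is killed by f, and at 1 it equals 1 - α₀(1).
  exact ⟨α₀ + α₁ - α₀ ∘ₗ f.toLinearMap ∘ₗ α₁, fun q => by simp [h₀], by simp [h₁],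
    (hc₀.add hc₁).sub (hc₀.comp (hfc.comp hc₁))⟩

theorem IsPrincipal.exists_unital_lColin_section [Nontrivial Q] (hD : D.IsPrincipal)
    (hf : D.IsMorphism E f) (hs : Function.Surjective f) :
    ∃ α : Q →ₗ[k] P, (∀ q, f (α q) = q) ∧ α 1 = 1 ∧ LColin E.left D.left α := by
  obtain ⟨α₀, h₀, hc₀⟩ := hD.exists_lColin_section hf hs
  obtain ⟨ρ, hρ, hρe⟩ := hD.exists_unital_lColin
  obtain ⟨φ, hφ⟩ := exists_unital_functional k Q
  set α₁ := ρ ∘ₗ ((TensorProduct.rid k C).toLinearMap ∘ₗ φ.lTensor C ∘ₗ E.left) with hα₁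
  have hc₁ : LColin E.left D.left α₁ := hρ.comp (left_functional_lColin E φ)
  have h₁ : α₁ 1 = 1 := by simp [hα₁, E.left_one, hφ, hρe]
  have hfc : LColin D.left E.left f.toLinearMap := hf.2
  exact ⟨α₀ + α₁ - α₀ ∘ₗ f.toLinearMap ∘ₗ α₁, fun q => by simp [h₀], by simp [h₁],
    (hc₀.add hc₁).sub (hc₀.comp (hfc.comp hc₁))⟩

end Sections

/-! ### Restricting coactions to subalgebras. -/

section Restriction

variable {D} {P' : Type*} [Ring P'] [Algebra k P'] {j : P' →ₐ[k] P}

theorem exists_lift_of_injective {V W X : Type*} [AddCommGroup V] [Module k V] [AddCommGroup W]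
    [Module k W] [AddCommGroup X] [Module k X] {i : V →ₗ[k] W} (hi : Function.Injective i)
    {g : X →ₗ[k] W} (hg : ∀ x, g x ∈ LinearMap.range i) : ∃ g' : X →ₗ[k] V, i ∘ₗ g' = g := by
  obtain ⟨r, hr⟩ := LinearMap.exists_leftInverse_of_injective i (LinearMap.ker_eq_bot.2 hi)
  refine ⟨r ∘ₗ g, LinearMap.ext fun x => ?_⟩
  obtain ⟨v, hv⟩ := hg x
  rw [LinearMap.comp_apply, LinearMap.comp_apply, ← hv]
  exact congrArg i (LinearMap.congr_fun hr v)

/-- Both coactions restrict to a subobject whenever their values allow it. -/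
theorem exists_restriction (hj : Function.Injective j)
    (hr : ∀ p, D.right (j p) ∈ LinearMap.range (j.toLinearMap.rTensor C))
    (hl : ∀ p, D.left (j p) ∈ LinearMap.range (j.toLinearMap.lTensor C)) :
    ∃ D' : CoaugCoactions k e P', D'.IsMorphism D j := by
  have hjr : ∀ (M : Type _) [AddCommGroup M] [Module k M],
      Function.Injective (j.toLinearMap.rTensor M) :=
    fun M _ _ => Module.Flat.rTensor_preserves_injective_linearMap (M := M) j.toLinearMap hj
  have hjl : ∀ (M : Type _) [AddCommGroup M] [Module k M],
      Function.Injective (j.toLinearMap.lTensor M) :=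
    fun M _ _ => Module.Flat.lTensor_preserves_injective_linearMap (M := M) j.toLinearMap hj
  obtain ⟨δ, hδ⟩ := exists_lift_of_injective (hjr C) (g := D.right ∘ₗ j.toLinearMap) hr
  obtain ⟨γ, hγ⟩ := exists_lift_of_injective (hjl C) (g := D.left ∘ₗ j.toLinearMap) hl
  have hδ' : ∀ p, j.toLinearMap.rTensor C (δ p) = D.right (j p) := LinearMap.congr_fun hδ
  have hγ' : ∀ p, j.toLinearMap.lTensor C (γ p) = D.left (j p) := LinearMap.congr_fun hγ
  refine ⟨⟨δ, γ, LinearMap.ext fun p => hjr (C ⊗[k] C) ?_, LinearMap.ext fun p => hj ?_,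
    LinearMap.ext fun p => ?_, LinearMap.ext fun p => hj ?_, hjr C ?_, hjl C ?_⟩,
    hδ.symm, hγ.symm⟩
  · have h1 : ∀ w : P' ⊗[k] C, j.toLinearMap.rTensor (C ⊗[k] C)
        (TensorProduct.assoc k P' C C (δ.rTensor C w)) =
        TensorProduct.assoc k P C C (D.right.rTensor C (j.toLinearMap.rTensor C w)) := by
      intro w
      induction w with
      | zero => simp
      | tmul p c =>
        simp only [LinearMap.rTensor_tmul, AlgHom.toLinearMap_apply, ← hδ']
        induction δ p with
        | zero => simp
        | tmul x y => simp
        | add a b ha hb => simp only [TensorProduct.add_tmul, map_add, ha, hb]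
      | add a b ha hb => simp only [map_add, ha, hb]
    have h2 : ∀ w : P' ⊗[k] C, j.toLinearMap.rTensor (C ⊗[k] C) ((Δ).lTensor P' w) =
        (Δ).lTensor P (j.toLinearMap.rTensor C w) := by
      intro w
      induction w with
      | zero => simp
      | tmul p c => simp
      | add a b ha hb => simp only [map_add, ha, hb]
    simp only [LinearMap.comp_apply, LinearEquiv.coe_coe, h1, h2, hδ']
    exact LinearMap.congr_fun D.right_coassoc (j p)
  · have h1 : ∀ w : P' ⊗[k] C, j (TensorProduct.rid k P' ((ε).lTensor P' w)) =
        TensorProduct.rid k P ((ε).lTensor P (j.toLinearMap.rTensor C w)) := by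
      intro w
      induction w with
      | zero => simp
      | tmul p c => simp
      | add a b ha hb => simp only [map_add, ha, hb]
    simp only [LinearMap.comp_apply, LinearEquiv.coe_coe, h1, hδ', right_counit_apply]
    rfl
  · have hinj : Function.Injective ((j.toLinearMap.lTensor C).lTensor C) :=
      Module.Flat.lTensor_preserves_injective_linearMap (M := C) _ (hjl C)
    apply hinj
    have h1 : ∀ w : C ⊗[k] P', (j.toLinearMap.lTensor C).lTensor C (γ.lTensor C w) =
        D.left.lTensor C (j.toLinearMap.lTensor C w) := by
      intro w
      induction w with
      | zero => simp
      | tmul p c => simp [hγ']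
      | add a b ha hb => simp only [map_add, ha, hb]
    have h2 : ∀ w : C ⊗[k] P', (j.toLinearMap.lTensor C).lTensor C
        (TensorProduct.assoc k C C P' ((Δ).rTensor P' w)) =
        TensorProduct.assoc k C C P ((Δ).rTensor P (j.toLinearMap.lTensor C w)) := by
      intro w
      induction w with
      | zero => simp
      | tmul c p =>
        simp only [LinearMap.rTensor_tmul, LinearMap.lTensor_tmul]
        induction Δ c with
        | zero => simp
        | tmul x y => simp
        | add a b ha hb => simp only [TensorProduct.add_tmul, map_add, ha, hb]
      | add a b ha hb => simp only [map_add, ha, hb]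
    simp only [LinearMap.comp_apply, LinearEquiv.coe_coe, h1, h2, hγ']
    exact LinearMap.congr_fun D.left_coassoc (j p)
  · have h1 : ∀ w : C ⊗[k] P', j (TensorProduct.lid k P' ((ε).rTensor P' w)) =
        TensorProduct.lid k P ((ε).rTensor P (j.toLinearMap.lTensor C w)) := by
      intro w
      induction w with
      | zero => simp
      | tmul p c => simp
      | add a b ha hb => simp only [map_add, ha, hb]
    simp only [LinearMap.comp_apply, LinearEquiv.coe_coe, h1, hγ', left_counit_apply]
    rfl
  · rw [hδ', map_one, D.right_one]; simp
  · rw [hγ', map_one, D.left_one]; simp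

theorem IsMorphism.unique_of_injective (hj : Function.Injective j) {D₁ D₂ : CoaugCoactions k e P'}
    (h₁ : D₁.IsMorphism D j) (h₂ : D₂.IsMorphism D j) : D₁ = D₂ := by
  refine CoaugCoactions.ext (LinearMap.ext fun p => ?_) (LinearMap.ext fun p => ?_)
  · apply Module.Flat.rTensor_preserves_injective_linearMap (M := C) j.toLinearMap hj
    rw [← h₁.right_apply, ← h₂.right_apply]
  · apply Module.Flat.lTensor_preserves_injective_linearMap (M := C) j.toLinearMap hj
    rw [← h₁.left_apply, ← h₂.left_apply]

end Restriction

/-! ### The preimage of a principal subobject. -/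

section Preimage

variable {D} {Q : Type*} [Ring Q] [Algebra k Q] {E : CoaugCoactions k e Q} {π : P →ₐ[k] Q}
  {Q' : Subalgebra k Q}

/-- The inclusion of the preimage of a subalgebra, as a linear map. -/
abbrev comapIncl (π : P →ₐ[k] Q) (Q' : Subalgebra k Q) : Q'.comap π →ₗ[k] P :=
  (Q'.comap π).val.toLinearMap

/-- The projection `1 - απ` onto the kernel of `π`, with values in the preimage of `Q'`. -/
def kerProj (Q' : Subalgebra k Q) {α : Q →ₗ[k] P} (hα : ∀ q, π (α q) = q) :
    P →ₗ[k] Q'.comap π where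
  toFun p := ⟨p - α (π p), by
    rw [Subalgebra.mem_comap, map_sub, hα, sub_self]; exact zero_mem _⟩
  map_add' a b := Subtype.ext (by simp; abel)
  map_smul' r a := Subtype.ext (by simp [smul_sub])

/-- A section of `π`, restricted to `Q'`. -/
def comapSection (Q' : Subalgebra k Q) {α : Q →ₗ[k] P} (hα : ∀ q, π (α q) = q) :
    Q' →ₗ[k] Q'.comap π where
  toFun q := ⟨α q, by rw [Subalgebra.mem_comap, hα]; exact q.2⟩
  map_add' a b := Subtype.ext (by simp)
  map_smul' r a := Subtype.ext (by simp)

theorem comapIncl_kerProj {α : Q →ₗ[k] P} (hα : ∀ q, π (α q) = q) :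
    comapIncl π Q' ∘ₗ kerProj Q' hα = LinearMap.id - α ∘ₗ π.toLinearMap := rfl

theorem comapIncl_comapSection {α : Q →ₗ[k] P} (hα : ∀ q, π (α q) = q) :
    comapIncl π Q' ∘ₗ comapSection Q' hα = α ∘ₗ Q'.val.toLinearMap := rfl

theorem map_kerProj {α : Q →ₗ[k] P} (hα : ∀ q, π (α q) = q) (p : P) :
    π (kerProj Q' hα p : P) = 0 := by
  change π (p - α (π p)) = 0
  rw [map_sub, hα, sub_self]

theorem rTensor_kerProj {M : Type*} [AddCommGroup M] [Module k M] {α : Q →ₗ[k] P}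
    (hα : ∀ q, π (α q) = q) (w : P ⊗[k] M) :
    (comapIncl π Q' ∘ₗ kerProj Q' hα).rTensor M w =
      w - α.rTensor M (π.toLinearMap.rTensor M w) := by
  rw [comapIncl_kerProj, LinearMap.rTensor_sub, LinearMap.rTensor_comp, LinearMap.rTensor_id]
  rfl

theorem lTensor_kerProj {M : Type*} [AddCommGroup M] [Module k M] {α : Q →ₗ[k] P}
    (hα : ∀ q, π (α q) = q) (w : M ⊗[k] P) :
    (comapIncl π Q' ∘ₗ kerProj Q' hα).lTensor M w =
      w - α.lTensor M (π.toLinearMap.lTensor M w) := by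
  rw [comapIncl_kerProj, LinearMap.lTensor_sub, LinearMap.lTensor_comp, LinearMap.lTensor_id]
  rfl

/-- Decompose w as (w - απ(w)) + απ(w): the first part has its leg in ker π, the second is α applied
to a tensor over Q'. -/
theorem mem_range_rTensor_comapIncl {M : Type*} [AddCommGroup M] [Module k M] {α : Q →ₗ[k] P}
    (hα : ∀ q, π (α q) = q) {w : P ⊗[k] M}
    (hw : π.toLinearMap.rTensor M w ∈ LinearMap.range (Q'.val.toLinearMap.rTensor M)) :
    w ∈ LinearMap.range ((comapIncl π Q').rTensor M) := by
  obtain ⟨v, hv⟩ := hw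
  have h : w = (comapIncl π Q' ∘ₗ kerProj Q' hα).rTensor M w +
      (comapIncl π Q' ∘ₗ comapSection Q' hα).rTensor M v := by
    rw [rTensor_kerProj, comapIncl_comapSection, LinearMap.rTensor_comp, LinearMap.comp_apply, hv]
    abel
  rw [h, LinearMap.rTensor_comp, LinearMap.rTensor_comp]
  exact add_mem ⟨_, rfl⟩ ⟨_, rfl⟩

theorem mem_range_lTensor_comapIncl {M : Type*} [AddCommGroup M] [Module k M] {α : Q →ₗ[k] P}
    (hα : ∀ q, π (α q) = q) {w : M ⊗[k] P}
    (hw : π.toLinearMap.lTensor M w ∈ LinearMap.range (Q'.val.toLinearMap.lTensor M)) :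
    w ∈ LinearMap.range ((comapIncl π Q').lTensor M) := by
  obtain ⟨v, hv⟩ := hw
  have h : w = (comapIncl π Q' ∘ₗ kerProj Q' hα).lTensor M w +
      (comapIncl π Q' ∘ₗ comapSection Q' hα).lTensor M v := by
    rw [lTensor_kerProj, comapIncl_comapSection, LinearMap.lTensor_comp, LinearMap.comp_apply, hv]
    abel
  rw [h, LinearMap.lTensor_comp, LinearMap.lTensor_comp]
  exact add_mem ⟨_, rfl⟩ ⟨_, rfl⟩

theorem rmul_mem_range_lTensor_comapIncl {z : P} (hz : π z = 0) (t : P ⊗[k] P) :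
    rmul z t ∈ LinearMap.range ((comapIncl π Q').lTensor P) := by
  induction t with
  | zero => simp
  | tmul x y =>
    exact ⟨x ⊗ₜ ⟨y * z, by rw [Subalgebra.mem_comap, map_mul, hz, mul_zero]; exact zero_mem _⟩,
      rfl⟩
  | add a b ha hb => rw [map_add]; exact add_mem ha hb

theorem smul_mem_range_map_comapIncl {z : P} (hz : π z = 0) {t : P ⊗[k] P}
    (ht : t ∈ LinearMap.range ((comapIncl π Q').lTensor P)) :
    z • t ∈ LinearMap.range (TensorProduct.map (comapIncl π Q') (comapIncl π Q')) := by
  obtain ⟨u, rfl⟩ := ht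
  induction u with
  | zero => simp
  | tmul x y =>
    exact ⟨⟨z * x, by rw [Subalgebra.mem_comap, map_mul, hz, zero_mul]; exact zero_mem _⟩ ⊗ₜ y,
      rfl⟩
  | add a b ha hb => rw [map_add, smul_add]; exact add_mem ha hb

/-- `P` has a strong connection with values in the preimage of a principal subobject. -/
theorem IsPrincipal.exists_strongConnection_mem (hD : D.IsPrincipal) (hπ : D.IsMorphism E π)
    (hs : Function.Surjective π) {E' : CoaugCoactions k e Q'} (hE' : E'.IsMorphism E Q'.val)
    (hQ' : E'.IsPrincipal) : ∃ l, D.StrongConnection l ∧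
      ∀ c, l c ∈ LinearMap.range (TensorProduct.map (comapIncl π Q') (comapIncl π Q')) := by
  obtain ⟨l, hl⟩ := hD.exists_strongConnection
  obtain ⟨m, hm⟩ := hQ'.exists_strongConnection
  obtain ⟨α, hα, hαc⟩ := hD.exists_rColin_section hπ hs
  obtain ⟨β, hβ, hβc⟩ := hD.exists_lColin_section hπ hs
  -- The left colinear section acts on the first leg and the right colinear one on the last, so L is
  -- bicolinear although neither section is.
  set L : C →ₗ[k] P ⊗[k] P :=
    TensorProduct.map (β ∘ₗ Q'.val.toLinearMap) (α ∘ₗ Q'.val.toLinearMap) ∘ₗ m with hL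
  have hLr : RColin Δ (lastCoaction P D.right) L :=
    (RColin.map _ (hαc.comp hE'.1)).comp hm.rColin
  have hLl : LColin Δ (firstCoaction P D.left) L :=
    (LColin.map _ (hβc.comp hE'.2)).comp hm.lColin
  have hLmem : ∀ c,
      L c ∈ LinearMap.range (TensorProduct.map (comapIncl π Q') (comapIncl π Q')) := by
    intro c
    refine ⟨TensorProduct.map (comapSection Q' hβ) (comapSection Q' hα) (m c), ?_⟩
    rw [← LinearMap.comp_apply, ← TensorProduct.map_comp]
    rfl
  have hLmem' : ∀ c, L c ∈ LinearMap.range ((comapIncl π Q').lTensor P) := by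
    intro c
    obtain ⟨u, hu⟩ := hLmem c
    refine ⟨(comapIncl π Q').rTensor _ u, ?_⟩
    rw [← hu, ← LinearMap.comp_apply, LinearMap.lTensor_comp_rTensor]
  have hLπ : ∀ c, TensorProduct.map π.toLinearMap π.toLinearMap (L c) =
      TensorProduct.map Q'.val.toLinearMap Q'.val.toLinearMap (m c) := by
    intro c
    rw [hL, LinearMap.comp_apply, ← LinearMap.comp_apply, ← TensorProduct.map_comp]
    congr 2
    · exact LinearMap.ext fun q => hβ _
    · exact LinearMap.ext fun q => hα _
  obtain ⟨h, hψ, -, hleft⟩ := id hD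
  have hM := hl.correct_right h hleft hLr hLl
  set M : C →ₗ[k] P ⊗[k] P := L + l - rext l ∘ₗ D.canLiftL ∘ₗ L with hMdef
  have hMmem : ∀ c, M c ∈ LinearMap.range ((comapIncl π Q').lTensor P) := by
    intro c
    -- This defect vanishes in C ⊗ Q because L lifts the strong connection m. Hence id - απ fixes
    -- it, and M(c) - L(c) has its last leg in ker π.
    set v := c ⊗ₜ[k] (1 : P) - D.canLiftL (L c) with hv
    have hv0 : π.toLinearMap.lTensor C v = 0 := by
      rw [hv, map_sub, ← hπ.canLiftL_map, hLπ, hE'.canLiftL_map, hm.canLiftL]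
      simp
    have hMc : M c = L c + rext l ((comapIncl π Q' ∘ₗ kerProj Q' hα).lTensor C v) := by
      rw [lTensor_kerProj, hv0, map_zero, sub_zero, hv, map_sub, rext_tmul, rmul_one, hMdef]
      simp only [LinearMap.sub_apply, LinearMap.add_apply, LinearMap.comp_apply]
      abel
    rw [hMc]
    refine add_mem (hLmem' c) ?_
    induction v with
    | zero => simp
    | tmul c p => exact rmul_mem_range_lTensor_comapIncl (map_kerProj (Q' := Q') hα p) (l c)
    | add a b ha hb => rw [map_add, map_add]; exact add_mem ha hb
  refine ⟨_, hM.correct_left h hψ.1 hleft hLr hLl, fun c => ?_⟩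
  -- The mirror correction uses M instead of l: its last leg is already in the preimage, and the
  -- factor from ker π puts the first leg there too.
  set w := (1 : P) ⊗ₜ[k] c - D.canLift (L c) with hw
  have hw0 : π.toLinearMap.rTensor C w = 0 := by
    rw [hw, map_sub, ← hπ.canLift_map, hLπ, hE'.canLift_map, hm.canLift]
    simp
  have hc : (L + M - sext M ∘ₗ D.canLift ∘ₗ L) c =
      L c + sext M ((comapIncl π Q' ∘ₗ kerProj Q' hα).rTensor C w) := by
    rw [rTensor_kerProj, hw0, map_zero, sub_zero, hw, map_sub, sext_tmul, one_smul]
    simp only [LinearMap.sub_apply, LinearMap.add_apply, LinearMap.comp_apply]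
    abel
  rw [hc]
  refine add_mem (hLmem c) ?_
  clear_value w
  clear hc hw hw0
  induction w with
  | zero => simp
  | tmul p c => exact smul_mem_range_map_comapIncl (map_kerProj (Q' := Q') hα p) (hMmem c)
  | add a b ha hb => rw [map_add, map_add]; exact add_mem ha hb

theorem IsPrincipal.exists_comap (hD : D.IsPrincipal) (hπ : D.IsMorphism E π)
    (hs : Function.Surjective π) {E' : CoaugCoactions k e Q'} (hE' : E'.IsMorphism E Q'.val)
    (hQ' : E'.IsPrincipal) :
    ∃ D' : CoaugCoactions k e (Q'.comap π), D'.IsMorphism D (Q'.comap π).val ∧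
      D'.IsPrincipal := by
  have hj : Function.Injective (Q'.comap π).val := Subtype.val_injective
  obtain ⟨α, hα, -⟩ := hD.exists_rColin_section hπ hs
  obtain ⟨D', hD'⟩ := exists_restriction (D := D) hj
    (fun p => mem_range_rTensor_comapIncl hα (by
      rw [← hπ.right_apply]
      exact ⟨E'.right ⟨π p, p.2⟩, (hE'.right_apply _).symm⟩))
    (fun p => mem_range_lTensor_comapIncl hα (by
      rw [← hπ.left_apply]
      exact ⟨E'.left ⟨π p, p.2⟩, (hE'.left_apply _).symm⟩))
  refine ⟨D', hD', ?_⟩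
  obtain ⟨l, hl, hmem⟩ := hD.exists_strongConnection_mem hπ hs hE' hQ'
  have hmap : Function.Injective (TensorProduct.map (comapIncl π Q') (comapIncl π Q')) := by
    rw [← LinearMap.rTensor_comp_lTensor]
    exact (Module.Flat.rTensor_preserves_injective_linearMap _ hj).comp
      (Module.Flat.lTensor_preserves_injective_linearMap _ hj)
  obtain ⟨l', rfl⟩ := exists_lift_of_injective hmap hmem
  exact (PrincipalData.of_injective hD.1 (hl.principalData hD) hD' hj).isPrincipal

end Preimage

end CoaugCoactions

/-! ### Assembly of the lemma. -/

theorem lemma2p1 {k : Type*} [Field k] {C : Type*} [AddCommGroup C] [Module k C] [Coalgebra k C]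
    {e : C} (he : IsGroupLikeElem k e)
    {P : Type*} [Ring P] [Algebra k P] {Q : Type*} [Ring Q] [Algebra k Q]
    (DP : CoaugCoactions k e P) (DQ : CoaugCoactions k e Q)
    (π : P →ₐ[k] Q) (hπ : DP.IsMorphism DQ π) (hsurj : Function.Surjective π)
    (hP : DP.IsPrincipal) :
    -- the induced map on coinvariants is well defined and surjective
    (∃ πco : DP.coinv →ₐ[k] DQ.coinv,
      (∀ b : DP.coinv, (πco b : Q) = π b) ∧ Function.Surjective πco) ∧
    -- unital right colinear splitting
    (Nontrivial Q → ∃ α : Q →ₗ[k] P,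
      (∀ q, π (α q) = q) ∧ α 1 = 1 ∧ DQ.RightColinear DP α) ∧
    -- unital left colinear splitting
    (Nontrivial Q → ∃ α : Q →ₗ[k] P,
      (∀ q, π (α q) = q) ∧ α 1 = 1 ∧ DQ.LeftColinear DP α) ∧
    DQ.IsPrincipal ∧
    -- for every principal subobject `Q'` of `Q`, the coactions of `P` restrict to the subalgebra
    -- `π⁻¹(Q')`, in exactly one way, and it is then principal
    (∀ (Q' : Subalgebra k Q) (DQ' : CoaugCoactions k e Q'),
      DQ'.IsMorphism DQ Q'.val → DQ'.IsPrincipal →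
      ∃ D : CoaugCoactions k e (Q'.comap π),
        (∀ D' : CoaugCoactions k e (Q'.comap π), D'.IsMorphism DP (Q'.comap π).val ↔ D' = D) ∧
        D.IsPrincipal) := by
  refine ⟨⟨⟨⟨⟨⟨fun b => ⟨π b, hπ.map_mem_coinv hsurj b.2⟩, ?_⟩, ?_⟩, ?_, ?_⟩, ?_⟩,
    fun b => rfl, ?_⟩, fun _ => hP.exists_unital_rColin_section hπ hsurj,
    fun _ => hP.exists_unital_lColin_section hπ hsurj, hP.of_surjective hπ hsurj,
    fun Q' DQ' hι hQ' => ?_⟩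
  · exact Subtype.ext (map_one π)
  · exact fun a b => Subtype.ext (map_mul π (a : P) (b : P))
  · exact Subtype.ext (map_zero π)
  · exact fun a b => Subtype.ext (map_add π (a : P) (b : P))
  · exact fun r => Subtype.ext (π.commutes r)
  · rintro ⟨b, hb⟩
    obtain ⟨a, ha, rfl⟩ := hP.exists_coinv_lift hπ hsurj hb
    exact ⟨⟨a, ha⟩, rfl⟩
  · obtain ⟨D, hD, hDP⟩ := hP.exists_comap hπ hsurj hι hQ'
    refine ⟨D, fun D' => ⟨fun h => h.unique_of_injective Subtype.val_injective hD, ?_⟩, hDP⟩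
    rintro rfl
    exact hD
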